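/- Write $\mathbb R^4=\mathbb R^2\times\mathbb R^2$, let $Y\subset\mathbb R^2$ be the union of three half lines issuing from the origin and making angles of $120^\circ$ with each other, and let $Y\times Y\subset\mathbb R^4$ be the orthogonal product of two such sets. A cone is a set stable under multiplication by every real $r\ge 0$. Say that a cone $C\subset\mathbb R^4$ satisfies condition (6.1) if its link $X=C\cap\partial B(0,1)$ is a finite union of great circles and closed arcs of great circles (each of positive length less than $2\pi$) such that the great circles are disjoint from each other and from the arcs, two different arcs can meet only at common endpoints, and each endpoint of an arc is an end of exactly three of the arcs, any two of which make an angle of $120^\circ$ there. Theorem 6.3. Up to isometry, $Y\times Y$ is the only cone in $\mathbb R^4$ that is homeomorphic to $Y\times Y$ and satisfies condition (6.1). That is, for every set $C\subset\mathbb R^4$, the following are equivalent: (a) $C$ is a cone, $C$ is homeomorphic to $Y\times Y$, and $C$ satisfies condition (6.1); (b) $C=g(Y\times Y)$ for some linear isometry $g$ of $\mathbb R^4$. In particular, a cone homeomorphic to $Y\times Y$, however close to $Y\times Y$, does not satisfy (6.1) unless it is the image of $Y\times Y$ under a linear isometry. -/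

import Mathlib

/-- A cone with vertex at the origin: a set stable under multiplication by all `r ≥ 0`. -/
def IsConeAtOrigin {E : Type*} [NormedAddCommGroup E] [InnerProductSpace ℝ E]
    (C : Set E) : Prop :=
  ∀ x ∈ C, ∀ r : ℝ, 0 ≤ r → r • x ∈ C

/-- The one-dimensional `Y` set in the plane: the union of three half lines issuing from the
origin, with directions `2πk/3`, `k = 0, 1, 2`. -/
def ySet : Set (EuclideanSpace ℝ (Fin 2)) :=
  {x | ∃ k : Fin 3, ∃ r : ℝ, 0 ≤ r ∧
    x = r • !₂[Real.cos (2 * Real.pi * (k : ℝ) / 3), Real.sin (2 * Real.pi * (k : ℝ) / 3)]}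

/-- The orthogonal product `Y × Y` in `ℝ⁴ = ℝ² × ℝ²`. -/
def YxY : Set (EuclideanSpace ℝ (Fin 4)) :=
  {x | !₂[x 0, x 1] ∈ ySet ∧ !₂[x 2, x 3] ∈ ySet}

/-- A great circle of the unit sphere. -/
def IsGreatCircle {E : Type*} [NormedAddCommGroup E] [InnerProductSpace ℝ E]
    (S : Set E) : Prop :=
  ∃ P : Submodule ℝ E, Module.finrank ℝ P = 2 ∧ S = (P : Set E) ∩ Metric.sphere 0 1

/-- A (nondegenerate, closed, proper) arc of a great circle of the unit sphere, given by its
starting point `p`, its unit tangent vector `u` at `p`, and its length. -/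
structure GreatArc (E : Type*) [NormedAddCommGroup E] [InnerProductSpace ℝ E] where
  p : E
  u : E
  len : ℝ
  norm_p : ‖p‖ = 1
  norm_u : ‖u‖ = 1
  inner_p_u : inner ℝ p u = 0
  len_pos : 0 < len
  len_lt : len < 2 * Real.pi

namespace GreatArc

variable {E : Type*} [NormedAddCommGroup E] [InnerProductSpace ℝ E]

/-- The arc-length parametrization of the great circle that carries the arc. -/
noncomputable def curve (A : GreatArc E) (t : ℝ) : E :=
  Real.cos t • A.p + Real.sin t • A.u

/-- The set of points of the arc, its two ends included. -/
def carrier (A : GreatArc E) : Set E :=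
  A.curve '' Set.Icc 0 A.len

/-- The two ends of the arc: `false` is the start, `true` the other end. -/
noncomputable def endpoint (A : GreatArc E) : Bool → E
  | false => A.p
  | true => A.curve A.len

/-- The unit tangent vector at an end of the arc, pointing into the arc. At the end `true` it is
minus the velocity of `curve` at `len`. -/
noncomputable def inward (A : GreatArc E) : Bool → E
  | false => A.u
  | true => Real.sin A.len • A.p - Real.cos A.len • A.u

end GreatArc

/-- The necessary condition for two-dimensional minimal cones: the intersection `X` of `C` with
the unit sphere is a finite union of great circles `G k` and of arcs of great circles `A i`;
the great circles are disjoint from each other and from the arcs (by compactness, each of them is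
then at positive distance from the rest of `X`); two arcs can meet only at common ends;
and at each end of an arc exactly three arcs end, any two of them with an angle of 120 degrees.
A pair `(i, s) : Fin n × Bool` stands for the end `s` of the arc `A i`. -/
def SatisfiesNetCondition {E : Type*} [NormedAddCommGroup E] [InnerProductSpace ℝ E]
    (C : Set E) : Prop :=
  ∃ (m n : ℕ) (G : Fin m → Set E) (A : Fin n → GreatArc E),
    (∀ k, IsGreatCircle (G k)) ∧
    C ∩ Metric.sphere 0 1 = (⋃ k, G k) ∪ (⋃ i, (A i).carrier) ∧
    (∀ k l, k ≠ l → Disjoint (G k) (G l)) ∧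
    (∀ k i, Disjoint (G k) (A i).carrier) ∧
    (∀ i j, i ≠ j → (A i).carrier ∩ (A j).carrier ⊆
      Set.range (A i).endpoint ∩ Set.range (A j).endpoint) ∧
    (∀ e : Fin n × Bool,
      {f : Fin n × Bool | (A f.1).endpoint f.2 = (A e.1).endpoint e.2}.ncard = 3) ∧
    (∀ e f : Fin n × Bool, e ≠ f → (A e.1).endpoint e.2 = (A f.1).endpoint f.2 →
      InnerProductGeometry.angle ((A e.1).inward e.2) ((A f.1).inward f.2) = 2 * Real.pi / 3)

/-!
The link of `Y × Y` is the graph `K₃,₃` drawn with nine quarter circles. The proof of uniqueness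
recovers the graph from the homeomorphism and then the geometry from the graph.

*Topology.* A point of a net cone other than the apex has a neighbourhood that embeds in the plane
(`PlanarAt`) if and only if it does not lie on a ray over a vertex of the net. On such a ray three
sheets meet, and three half discs glued along a diameter do not embed in the plane
(`false_of_three_halfDiscs`): by the homotopy argument for Borsuk's theorem on odd maps, an injective
map of the disc has odd winding number around the image of the centre, and three odd numbers with
sum zero do not exist. So a homeomorphism between net cones preserves the rays over vertices. It
preserves the apex, at which several of these rays are joined (`IsNetCone.map_zero`), hence also the
cones over the open arcs and great circles, and the incidence between arcs and vertices
(`IsNetCone.exists_bipartite`). A net cone homeomorphic to `Y × Y` thus has `K₃,₃` as its net.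

*Geometry.* Let `a i` and `b j` be the vertices. At `a i` the three tangent vectors span a plane, and
together with `a i` a three-dimensional space that contains all the `b j`. If these spaces all
agree, the net lies on a two-dimensional sphere, and a stereographic projection contradicts the
nonplanarity of `K₃,₃` (`false_of_planar_K33`). Otherwise the `b j` lie in a plane, which does not
contain `a i`, and the sum of the tangent vectors at `a i` vanishes only if
`∑ j, b j / sin ℓ i j = 0` and `∑ j, cot (ℓ i j) = 0`, where `ℓ i j` is the length of the arc. Hence
`sin (ℓ i j) = x i * y j`. The angles at `a i` say that the Gram matrix of the `b j / y j` is the sum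
of the rank one matrix of the products `⟪a i, b j / y j⟫ * ⟪a i, b l / y l⟫` and of `x i ^ 2` times a
fixed form. This determines `x i ^ 2`, so the numbers `⟪a i, b j / y j⟫` are independent of `i` up
to sign, and as `∑ i, ⟪a i, b j / y j⟫ / x i = 0` they vanish (`cos_eq_zero_of_rank_one`). The
arcs then have length `π / 2` or `3 * π / 2`. Two long arcs with a common end would cross, and since
the signs of the sines have rank one, no arc is long (`IsBipartiteNet.sin_eq_one`). So the `a i` and
the `b j` form two orthogonal triples with angles of 120 degrees.
-/

/-! ### Continuous logarithms -/

theorem exists_continuous_log {A : Type*} [TopologicalSpace A] [SimplyConnectedSpace A]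
    [LocallyPathConnectedSpace A] {f : A → ℂ} (hf : Continuous f) (h0 : ∀ a, f a ≠ 0) :
    ∃ L : A → ℂ, Continuous L ∧ ∀ a, Complex.exp (L a) = f a := by
  obtain ⟨a₀⟩ : Nonempty A := inferInstance
  obtain ⟨F, ⟨-, hF⟩, -⟩ := Complex.isCoveringMapOn_exp.existsUnique_continuousMap_lifts
    ⟨f, hf⟩ (a₀ := a₀) (e₀ := Complex.log (f a₀)) (Complex.exp_log (h0 a₀)) h0
  exact ⟨F, F.continuous, fun a ↦ congrFun hF a⟩

/-- Two continuous logarithms of functions that differ by a constant factor differ by an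
additive constant. -/
theorem log_sub_log_eq {A : Type*} [TopologicalSpace A] {s : Set A} (hs : IsPreconnected s)
    {L M : A → ℂ} (hL : ContinuousOn L s) (hM : ContinuousOn M s) {c : ℂ}
    (h : ∀ a ∈ s, Complex.exp (L a) = c * Complex.exp (M a)) {a b : A} (ha : a ∈ s) (hb : b ∈ s) :
    L a - M a = L b - M b := by
  have key : ∀ x ∈ s, Complex.exp (L x - M x) = c := fun x hx ↦ by
    rw [Complex.exp_sub, h x hx, mul_div_assoc, div_self (Complex.exp_ne_zero _), mul_one]
  refine Complex.isCoveringMap_exp.constOn_of_comp hs (hL.sub hM) (fun x hx y hy ↦ ?_) ha hb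
  simp only [Pi.sub_apply, key x hx, key y hy]

/-! ### Three half discs with a common diameter do not embed in the plane -/

/-- The argument of `d z - d 0` grows by an odd multiple of `2π` along the unit circle: the
homotopy `d z - d (-s z)`, `0 ≤ s ≤ 1`, joins this function to an odd one without vanishing. -/
theorem exists_log_increment_eq_two_mul {d : ℂ → ℂ} (hc : ContinuousOn d (Metric.closedBall 0 1))
    (hi : Set.InjOn d (Metric.closedBall 0 1)) {L : ℝ → ℂ} (hL : Continuous L)
    (hexp : ∀ t : ℝ, Complex.exp (L t) = d (Complex.exp (t * Complex.I)) - d 0) (t₀ : ℝ) :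
    ∃ c : ℂ, Complex.exp c = -1 ∧ L (t₀ + 2 * Real.pi) - L t₀ = 2 * c := by
  let σ : ℝ → ℝ := fun s ↦ Set.projIcc (0 : ℝ) 1 zero_le_one s
  have hσ : Continuous σ := continuous_subtype_val.comp continuous_projIcc
  have hσ0 : ∀ s, 0 ≤ σ s := fun s ↦ (Set.projIcc (0 : ℝ) 1 zero_le_one s).2.1
  have hσ1 : ∀ s, σ s ≤ 1 := fun s ↦ (Set.projIcc (0 : ℝ) 1 zero_le_one s).2.2
  have hσz : σ 0 = 0 := by simp [σ]
  have hσo : σ 1 = 1 := by simp [σ]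
  let e : ℝ → ℂ := fun t ↦ Complex.exp (t * Complex.I)
  have he : Continuous e := by fun_prop
  have hen : ∀ t, ‖e t‖ = 1 := fun t ↦ Complex.norm_exp_ofReal_mul_I t
  have m1 : ∀ t, e t ∈ Metric.closedBall (0 : ℂ) 1 := fun t ↦ by simp [hen]
  have m2 : ∀ s t, -(σ s : ℂ) * e t ∈ Metric.closedBall (0 : ℂ) 1 := fun s t ↦ by
    simpa [hen, abs_of_nonneg (hσ0 s)] using hσ1 s
  let F : ℝ × ℝ → ℂ := fun q ↦ d (e q.2) - d (-(σ q.1 : ℂ) * e q.2)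
  have hF : Continuous F := by
    refine Continuous.sub (hc.comp_continuous (by fun_prop) fun q ↦ m1 _)
      (hc.comp_continuous (by fun_prop) fun q ↦ m2 _ _)
  have hF0 : ∀ q, F q ≠ 0 := by
    intro q h
    have h1 := hi (m1 _) (m2 _ _) (sub_eq_zero.1 h)
    have h2 : (1 + (σ q.1 : ℂ)) * e q.2 = 0 := by linear_combination h1
    rcases mul_eq_zero.1 h2 with h3 | h3
    · have : (1 : ℝ) + σ q.1 = 0 := by exact_mod_cast h3
      linarith [hσ0 q.1]
    · exact Complex.exp_ne_zero _ h3
  obtain ⟨M, hM, hMe⟩ := exists_continuous_log hF hF0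
  have hper : ∀ t, e (t + Real.pi) = -e t := fun t ↦ by
    simp only [e]; push_cast
    rw [add_mul, Complex.exp_add, Complex.exp_pi_mul_I]; ring
  have hper2 : ∀ t, e (t + 2 * Real.pi) = e t := fun t ↦ by
    rw [two_mul, ← add_assoc, hper, hper, neg_neg]
  have e1 : L (t₀ + 2 * Real.pi) - M (0, t₀ + 2 * Real.pi) = L t₀ - M (0, t₀) := by
    refine log_sub_log_eq (s := Set.univ) (c := 1) (M := fun t ↦ M (0, t)) isPreconnected_univ
      hL.continuousOn (by fun_prop) (fun t _ ↦ ?_) (Set.mem_univ _) (Set.mem_univ _)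
    rw [hMe, hexp]; simp [F, hσz, e]
  have e2 : M (0, t₀ + 2 * Real.pi) - M (0, t₀) = M (1, t₀ + 2 * Real.pi) - M (1, t₀) := by
    refine log_sub_log_eq (s := Set.univ) (c := 1) (L := fun s ↦ M (s, t₀ + 2 * Real.pi))
      (M := fun s ↦ M (s, t₀)) isPreconnected_univ
      (by fun_prop) (by fun_prop) (fun t _ ↦ ?_) (Set.mem_univ _) (Set.mem_univ _)
    rw [hMe, hMe]; simp [F, hper2]
  have odd : ∀ t, Complex.exp (M (1, t + Real.pi)) = -1 * Complex.exp (M (1, t)) := fun t ↦ by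
    rw [hMe, hMe]; simp [F, hper, hσo]
  have e3 : M (1, t₀ + Real.pi + Real.pi) - M (1, t₀ + Real.pi)
      = M (1, t₀ + Real.pi) - M (1, t₀) :=
    log_sub_log_eq (s := Set.univ) (L := fun s ↦ M (1, s + Real.pi))
      (M := fun s ↦ M (1, s)) isPreconnected_univ
      (by fun_prop) (by fun_prop) (fun t _ ↦ odd t) (Set.mem_univ _) (Set.mem_univ _)
  refine ⟨M (1, t₀ + Real.pi) - M (1, t₀), ?_, ?_⟩
  · rw [Complex.exp_sub, odd, mul_div_assoc, div_self (Complex.exp_ne_zero _), mul_one]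
  · have : t₀ + 2 * Real.pi = t₀ + Real.pi + Real.pi := by ring
    rw [this] at e1 e2 ⊢
    linear_combination e1 + e2 + e3

/-- The closed right half of the unit disc. -/
def halfDisc : Set ℂ := Metric.closedBall 0 1 ∩ {z | 0 ≤ z.re}

/-- Three half discs glued along their common diameter do not embed in the plane. The increments
of the argument along the three half circles would pairwise differ by odd multiples of `2π`. -/
theorem false_of_three_halfDiscs (h : Fin 3 → ℂ → ℂ) (hc : ∀ k, ContinuousOn (h k) halfDisc)
    (hglue : ∀ k l, ∀ z ∈ halfDisc, z.re = 0 → h k z = h l z)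
    (hi : ∀ k l, ∀ z ∈ halfDisc, ∀ w ∈ halfDisc, h k z = h l w → z = w ∧ (k = l ∨ z.re = 0)) :
    False := by
  let ρ : ℂ → ℂ := fun z ↦ ⟨|z.re|, z.im⟩
  have hρ : Continuous ρ := by
    have : ρ = fun z ↦ ((|z.re| : ℝ) : ℂ) + (z.im : ℂ) * Complex.I := by
      ext z; exact (Complex.mk_eq_add_mul_I _ _)
    rw [this]; fun_prop
  have hρn : ∀ z, ‖ρ z‖ = ‖z‖ := fun z ↦ by
    simp [Complex.norm_def, Complex.normSq_apply, ρ]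
  have hρm : ∀ z ∈ Metric.closedBall (0 : ℂ) 1, ρ z ∈ halfDisc := fun z hz ↦ by
    refine ⟨by simpa [hρn] using hz, ?_⟩
    simp [ρ]
  have hρid : ∀ z : ℂ, 0 ≤ z.re → ρ z = z := fun z hz ↦ by
    apply Complex.ext <;> simp [ρ, abs_of_nonneg hz]
  let e : ℝ → ℂ := fun t ↦ Complex.exp (t * Complex.I)
  have he : Continuous e := by fun_prop
  have m1 : ∀ t, e t ∈ Metric.closedBall (0 : ℂ) 1 := fun t ↦ by
    simp [e, Complex.norm_exp_ofReal_mul_I t]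
  have ere : ∀ t, (e t).re = Real.cos t := fun t ↦ Complex.exp_ofReal_mul_I_re t
  have eim : ∀ t, (e t).im = Real.sin t := fun t ↦ Complex.exp_ofReal_mul_I_im t
  have z0 : (0 : ℂ) ∈ halfDisc := by simp [halfDisc]
  have hlog : ∀ k, ∃ M : ℝ → ℂ, Continuous M ∧
      ∀ t, Complex.exp (M t) = h k (ρ (e t)) - h k 0 := by
    intro k
    refine exists_continuous_log (((hc k).comp_continuous (hρ.comp he)
      fun t ↦ hρm _ (m1 t)).sub continuous_const) fun t h0 ↦ ?_
    have := (hi k k _ (hρm _ (m1 t)) _ z0 (sub_eq_zero.1 h0)).1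
    have h2 := hρn (e t)
    rw [this] at h2
    simp [e, Complex.norm_exp_ofReal_mul_I t] at h2
  choose M hM hMe using hlog
  have key : ∀ k l, k ≠ l → ∃ c : ℂ, Complex.exp c = -1 ∧
      (M k (Real.pi / 2) - M k (-(Real.pi / 2))) - (M l (Real.pi / 2) - M l (-(Real.pi / 2)))
        = 2 * c := by
    intro k l hkl
    -- the disc formed by the sheets `k` and `l`
    let d : ℂ → ℂ := fun z ↦ if 0 ≤ z.re then h k (ρ z) else h l (ρ z)
    have hdk : ∀ z : ℂ, 0 ≤ z.re → d z = h k (ρ z) := fun z hz ↦ if_pos hz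
    have hdl : ∀ z ∈ Metric.closedBall (0 : ℂ) 1, z.re ≤ 0 → d z = h l (ρ z) := fun z hz hz0 ↦ by
      rcases hz0.lt_or_eq with h1 | h1
      · exact if_neg (not_le.2 h1)
      · rw [hdk z h1.ge]
        exact hglue _ _ _ (hρm z hz) (by simp [ρ, h1])
    have hdc : ContinuousOn d (Metric.closedBall 0 1) := by
      have hU : Metric.closedBall (0 : ℂ) 1 = (Metric.closedBall 0 1 ∩ {z | 0 ≤ z.re}) ∪
          (Metric.closedBall 0 1 ∩ {z | z.re ≤ 0}) := by
        rw [← Set.inter_union_distrib_left, eq_comm, Set.inter_eq_left]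
        exact fun z _ ↦ le_total 0 z.re
      rw [hU]
      refine ContinuousOn.union_of_isClosed ?_ ?_ ?_ ?_
      · exact ((hc k).comp hρ.continuousOn fun z hz ↦ hρm z hz.1).congr fun z hz ↦ hdk z hz.2
      · exact ((hc l).comp hρ.continuousOn fun z hz ↦ hρm z hz.1).congr
          fun z hz ↦ hdl z hz.1 hz.2
      · exact Metric.isClosed_closedBall.inter (isClosed_le continuous_const Complex.continuous_re)
      · exact Metric.isClosed_closedBall.inter (isClosed_le Complex.continuous_re continuous_const)
    have hdi : Set.InjOn d (Metric.closedBall 0 1) := by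
      have hρi : ∀ z w : ℂ, ρ z = ρ w → (0 ≤ z.re ↔ 0 ≤ w.re) ∨ (ρ z).re = 0 → z = w := by
        intro z w hzw hs
        have h1 : |z.re| = |w.re| := (Complex.ext_iff.1 hzw).1
        have h2 : z.im = w.im := (Complex.ext_iff.1 hzw).2
        refine Complex.ext ?_ h2
        rcases hs with hs | hs
        · by_cases hz : 0 ≤ z.re
          · rwa [abs_of_nonneg hz, abs_of_nonneg (hs.1 hz)] at h1
          · have hw := fun h' ↦ hz (hs.2 h')
            rw [abs_of_neg (not_le.1 hz), abs_of_neg (not_le.1 hw)] at h1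
            linarith
        · have h3 : |z.re| = 0 := hs
          rw [h3] at h1
          rw [abs_eq_zero.1 h3, abs_eq_zero.1 h1.symm]
      intro z hz w hw hzw
      by_cases h1 : 0 ≤ z.re <;> by_cases h2 : 0 ≤ w.re
      · simp only [d, h1, h2, if_true] at hzw
        exact hρi _ _ (hi _ _ _ (hρm z hz) _ (hρm w hw) hzw).1 (Or.inl (by tauto))
      · simp only [d, h1, h2, if_true, if_false] at hzw
        have := (hi _ _ _ (hρm z hz) _ (hρm w hw) hzw)
        exact hρi _ _ this.1 (Or.inr (this.2.resolve_left hkl))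
      · simp only [d, h1, h2, if_true, if_false] at hzw
        have := (hi _ _ _ (hρm z hz) _ (hρm w hw) hzw)
        exact hρi _ _ this.1 (Or.inr (this.2.resolve_left hkl.symm))
      · simp only [d, h1, h2, if_false] at hzw
        exact hρi _ _ (hi _ _ _ (hρm z hz) _ (hρm w hw) hzw).1 (Or.inl (by tauto))
    have hd0 : d 0 = h k 0 := by rw [hdk 0 (by simp), hρid 0 (by simp)]
    obtain ⟨L, hL, hLe⟩ := exists_continuous_log (f := fun t ↦ d (e t) - d 0)
      ((hdc.comp_continuous he m1).sub continuous_const) (fun t h0 ↦ by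
        have := hdi (m1 t) (by simp) (sub_eq_zero.1 h0)
        exact Complex.exp_ne_zero _ this)
    obtain ⟨c, hc1, hc2⟩ := exists_log_increment_eq_two_mul hdc hdi hL hLe (-(Real.pi / 2))
    refine ⟨c, hc1, ?_⟩
    have hpi := Real.pi_pos
    have a1 : L (Real.pi / 2) - M k (Real.pi / 2) = L (-(Real.pi / 2)) - M k (-(Real.pi / 2)) := by
      refine log_sub_log_eq (s := Set.Icc (-(Real.pi / 2)) (Real.pi / 2)) (c := 1)
        isPreconnected_Icc hL.continuousOn (hM k).continuousOn (fun t ht ↦ ?_)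
        ⟨by linarith, le_rfl⟩ ⟨le_rfl, by linarith⟩
      rw [hLe, hMe, one_mul, hd0, hdk]
      rw [ere]; exact Real.cos_nonneg_of_mem_Icc ht
    have a2 : L (3 * Real.pi / 2) - M l (3 * Real.pi / 2) =
        L (Real.pi / 2) - M l (Real.pi / 2) := by
      refine log_sub_log_eq (s := Set.Icc (Real.pi / 2) (3 * Real.pi / 2)) (c := 1)
        isPreconnected_Icc hL.continuousOn (hM l).continuousOn (fun t ht ↦ ?_)
        ⟨by linarith, le_rfl⟩ ⟨le_rfl, by linarith⟩
      rw [hLe, hMe, one_mul, hd0, hdl _ (m1 t), hglue k l 0 z0 rfl]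
      rw [ere]
      exact Real.cos_nonpos_of_pi_div_two_le_of_le ht.1 (by linarith [ht.2])
    -- the logarithm along the left half circle, run through by reflection of the right one
    have a3 : M l (Real.pi - -(Real.pi / 2)) - M l (-(Real.pi / 2))
        = M l (Real.pi - Real.pi / 2) - M l (Real.pi / 2) := by
      refine log_sub_log_eq (s := Set.univ) (c := 1) (L := fun t ↦ M l (Real.pi - t))
        isPreconnected_univ ((hM l).comp (by fun_prop)).continuousOn (hM l).continuousOn
        (fun t _ ↦ ?_) (Set.mem_univ _) (Set.mem_univ _)
      rw [hMe, hMe, one_mul]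
      have : ρ (e (Real.pi - t)) = ρ (e t) := by
        apply Complex.ext
        · change |(e (Real.pi - t)).re| = |(e t).re|
          rw [ere, ere, Real.cos_pi_sub, abs_neg]
        · change (e (Real.pi - t)).im = (e t).im
          rw [eim, eim, Real.sin_pi_sub]
      rw [this]
    have r1 : Real.pi - -(Real.pi / 2) = 3 * Real.pi / 2 := by ring
    have r2 : Real.pi - Real.pi / 2 = Real.pi / 2 := by ring
    have r3 : -(Real.pi / 2) + 2 * Real.pi = 3 * Real.pi / 2 := by ring
    rw [r1, r2] at a3
    rw [r3] at hc2
    linear_combination hc2 - a1 - a2 - a3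
  obtain ⟨c, hc, h1⟩ := key 0 1 (by decide)
  obtain ⟨c', hc', h2⟩ := key 1 2 (by decide)
  obtain ⟨c'', hc'', h3⟩ := key 2 0 (by decide)
  have hsum : c + c' + c'' = 0 := by linear_combination -(h1 + h2 + h3) / 2
  have := congrArg Complex.exp hsum
  rw [Complex.exp_add, Complex.exp_add, hc, hc', hc'', Complex.exp_zero] at this
  norm_num at this

/-! ### The graph `K₃,₃` is not planar -/

/-- The graph `K₃,₃` does not embed in the plane, not even if edges with a common end are allowed
to meet. With `W i j v` the increment of `log (γ i j - v)`, the sums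
`T i = ∑ j, (W i j B_{j+1} - W i (j+1) B_j)` satisfy `exp (T i) = -1`, while a logarithm of
`γ i j s - γ k l t` on the square gives `T i + T k = 0` for `i ≠ k`. -/
theorem false_of_planar_K33 (a b : Fin 3 → ℂ) (γ : Fin 3 → Fin 3 → ℝ → ℂ)
    (hc : ∀ i j, Continuous (γ i j)) (h0 : ∀ i j, γ i j 0 = a i) (h1 : ∀ i j, γ i j 1 = b j)
    (hd : ∀ i j k l, i ≠ k → j ≠ l → ∀ s t, γ i j s ≠ γ k l t) : False := by
  have hinc : ∀ g : ℝ → ℂ, Continuous g → (∀ t, g t ≠ 0) → ∃ w : ℂ, Complex.exp w = g 1 / g 0 ∧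
      ∀ L : ℝ → ℂ, Continuous L → ∀ c : ℂ, (∀ t, Complex.exp (L t) = c * g t) →
        L 1 - L 0 = w := by
    intro g hg hg0
    obtain ⟨M, hM, hMe⟩ := exists_continuous_log hg hg0
    refine ⟨M 1 - M 0, by rw [Complex.exp_sub, hMe, hMe], fun L hL c hLe ↦ ?_⟩
    have := log_sub_log_eq (s := Set.univ) (c := c) isPreconnected_univ hL.continuousOn
      hM.continuousOn (fun t _ ↦ by rw [hLe, hMe]) (Set.mem_univ 1) (Set.mem_univ 0)
    linear_combination this
  have hA : ∀ i j k, i ≠ k → ∃ w : ℂ, ∀ L : ℝ → ℂ, Continuous L → ∀ c : ℂ,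
      (∀ t, Complex.exp (L t) = c * (γ i j t - a k)) → L 1 - L 0 = w := by
    intro i j k hik
    obtain ⟨w, -, hw⟩ := hinc (fun t ↦ γ i j t - a k) ((hc i j).sub continuous_const) fun t h ↦ by
      obtain ⟨l, hl⟩ := exists_ne j
      exact hd i j k l hik hl.symm t 0 (by rw [h0]; exact sub_eq_zero.1 h)
    exact ⟨w, hw⟩
  have hB : ∀ i j l, ∃ w : ℂ, j ≠ l → Complex.exp w = (b j - b l) / (a i - b l) ∧
      ∀ L : ℝ → ℂ, Continuous L → ∀ c : ℂ,
      (∀ t, Complex.exp (L t) = c * (γ i j t - b l)) → L 1 - L 0 = w := by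
    intro i j l
    by_cases hjl : j = l
    · exact ⟨0, fun h ↦ (h hjl).elim⟩
    obtain ⟨w, hw0, hw⟩ := hinc (fun t ↦ γ i j t - b l) ((hc i j).sub continuous_const) fun t h ↦ by
      obtain ⟨k, hk⟩ := exists_ne i
      exact hd i j k l hk.symm hjl t 1 (by rw [h1]; exact sub_eq_zero.1 h)
    refine ⟨w, fun _ ↦ ⟨?_, hw⟩⟩
    rw [hw0]; simp only [h0, h1]
  choose! W hW using hA
  choose V hV using hB
  have square : ∀ i j k l, i ≠ k → j ≠ l → W i j k + V k l j = W k l i + V i j l := by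
    intro i j k l hik hjl
    obtain ⟨L, hL, hLe⟩ := exists_continuous_log (A := ℝ × ℝ)
      (f := fun q ↦ γ i j q.1 - γ k l q.2)
      (((hc i j).comp continuous_fst).sub ((hc k l).comp continuous_snd))
      fun q h ↦ hd i j k l hik hjl _ _ (sub_eq_zero.1 h)
    have s1 := hW i j k hik (fun s ↦ L (s, 0)) (by fun_prop) 1
      fun t ↦ by rw [hLe]; simp [h0]
    have s2 := (hV i j l hjl).2 (fun s ↦ L (s, 1)) (by fun_prop) 1
      fun t ↦ by rw [hLe]; simp [h1]
    have s3 := hW k l i hik.symm (fun s ↦ L (0, s)) (by fun_prop) (-1)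
      fun t ↦ by rw [hLe]; simp [h0]
    have s4 := (hV k l j hjl.symm).2 (fun s ↦ L (1, s)) (by fun_prop) (-1)
      fun t ↦ by rw [hLe]; simp [h1]
    linear_combination -s1 - s4 + s3 + s2
  let T : Fin 3 → ℂ := fun i ↦
    V i 0 1 - V i 1 0 + (V i 1 2 - V i 2 1) + (V i 2 0 - V i 0 2)
  have hT : ∀ i k, i ≠ k → T i + T k = 0 := by
    intro i k hik
    have e1 := square i 0 k 1 hik (by decide)
    have e2 := square i 1 k 0 hik (by decide)
    have e3 := square i 1 k 2 hik (by decide)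
    have e4 := square i 2 k 1 hik (by decide)
    have e5 := square i 2 k 0 hik (by decide)
    have e6 := square i 0 k 2 hik (by decide)
    simp only [T]
    linear_combination e2 - e1 + e4 - e3 + e6 - e5
  have hT0 : T 0 = 0 := by
    linear_combination (hT 0 1 (by decide) + hT 2 0 (by decide) - hT 1 2 (by decide)) / 2
  have hab : ∀ i j, a i - b j ≠ 0 := fun i j h ↦ by
    obtain ⟨k, hk⟩ := exists_ne i
    obtain ⟨l, hl⟩ := exists_ne j
    exact hd i l k j hk.symm hl 0 1 (by rw [h0, h1]; exact sub_eq_zero.1 h)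
  have hbb : ∀ j l, j ≠ l → b j - b l ≠ 0 := fun j l hjl h ↦ by
    exact hd 0 j 1 l (by decide) hjl 1 1 (by rw [h1, h1]; exact sub_eq_zero.1 h)
  have hexp := congrArg Complex.exp hT0
  simp only [T, Complex.exp_add, Complex.exp_sub, (hV 0 0 1 (by decide)).1,
    (hV 0 1 0 (by decide)).1, (hV 0 1 2 (by decide)).1, (hV 0 2 1 (by decide)).1,
    (hV 0 2 0 (by decide)).1, (hV 0 0 2 (by decide)).1, Complex.exp_zero] at hexp
  rw [← neg_sub (b 0) (b 1), ← neg_sub (b 1) (b 2), ← neg_sub (b 2) (b 0)] at hexp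
  have n1 := hab 0 0
  have n2 := hab 0 1
  have n3 := hab 0 2
  have n4 := hbb 0 1 (by decide)
  have n5 := hbb 1 2 (by decide)
  have n6 := hbb 2 0 (by decide)
  field_simp at hexp
  norm_num at hexp

/-! ### Arcs of great circles -/

namespace GreatArc

variable {E : Type*} [NormedAddCommGroup E] [InnerProductSpace ℝ E]

/-- The relative interior of an arc. -/
def interior (A : GreatArc E) : Set E :=
  A.curve '' Set.Ioo 0 A.len

/-- The arc-length parametrization of the arc that starts at a given end. -/
noncomputable def fromEnd (A : GreatArc E) (s : Bool) (t : ℝ) : E :=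
  Real.cos t • A.endpoint s + Real.sin t • A.inward s

theorem curve_zero (A : GreatArc E) : A.curve 0 = A.p := by simp [curve]

theorem continuous_curve (A : GreatArc E) : Continuous A.curve := by
  unfold curve; fun_prop

theorem inner_p_curve (A : GreatArc E) (t : ℝ) : inner ℝ A.p (A.curve t) = Real.cos t := by
  simp [curve, inner_add_right, inner_smul_right, A.inner_p_u, A.norm_p]

theorem inner_u_curve (A : GreatArc E) (t : ℝ) : inner ℝ A.u (A.curve t) = Real.sin t := by
  simp [curve, inner_add_right, inner_smul_right, real_inner_comm A.p A.u, A.inner_p_u, A.norm_u]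

theorem norm_cos_add_sin {p u : E} (hp : ‖p‖ = 1) (hu : ‖u‖ = 1) (h : inner ℝ p u = 0) (t : ℝ) :
    ‖Real.cos t • p + Real.sin t • u‖ = 1 := by
  have : ‖Real.cos t • p + Real.sin t • u‖ ^ 2 = 1 := by
    rw [norm_add_sq_real, norm_smul, norm_smul, hp, hu, inner_smul_left, inner_smul_right, h]
    simp
  nlinarith [norm_nonneg (Real.cos t • p + Real.sin t • u)]

theorem norm_curve (A : GreatArc E) (t : ℝ) : ‖A.curve t‖ = 1 :=
  norm_cos_add_sin A.norm_p A.norm_u A.inner_p_u t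

theorem curve_injOn (A : GreatArc E) : Set.InjOn A.curve (Set.Ico 0 (2 * Real.pi)) := by
  intro s hs t ht h
  have hc : Real.cos s = Real.cos t := by rw [← A.inner_p_curve, h, A.inner_p_curve]
  have hs' : Real.sin s = Real.sin t := by rw [← A.inner_u_curve, h, A.inner_u_curve]
  obtain ⟨k, hk⟩ := Real.Angle.angle_eq_iff_two_pi_dvd_sub.1 (Real.Angle.cos_sin_inj hc hs')
  have hpi := Real.pi_pos
  have h1 : (k : ℝ) < 1 := by
    by_contra! h1
    nlinarith [hs.2, ht.1]
  have h2 : (-1 : ℝ) < k := by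
    by_contra! h1
    nlinarith [hs.1, ht.2]
  have h3 : k = 0 := by
    have : k < 1 := by exact_mod_cast h1
    have : -1 < k := by exact_mod_cast h2
    omega
  rw [h3] at hk
  simp at hk; linarith

theorem mem_Ico_of_mem_Icc (A : GreatArc E) {t : ℝ} (ht : t ∈ Set.Icc 0 A.len) :
    t ∈ Set.Ico 0 (2 * Real.pi) := ⟨ht.1, ht.2.trans_lt A.len_lt⟩

theorem fromEnd_true (A : GreatArc E) (t : ℝ) : A.fromEnd true t = A.curve (A.len - t) := by
  simp only [fromEnd, endpoint, inward, curve, Real.cos_sub, Real.sin_sub]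
  module

theorem inward_eq (A : GreatArc E) (s : Bool) :
    A.inward s = Real.sin A.len • A.endpoint (!s) - Real.cos A.len • A.inward (!s) := by
  have h := Real.sin_sq_add_cos_sq A.len
  cases s
  · simp only [inward, endpoint, curve, Bool.not_false]
    calc A.u = (Real.sin A.len ^ 2 + Real.cos A.len ^ 2) • A.u := by rw [h, one_smul]
      _ = _ := by module
  · rfl

/-- Each end is the image of the other one under the exponential map along the arc. -/
theorem endpoint_eq (A : GreatArc E) (s : Bool) :
    A.endpoint (!s) = Real.cos A.len • A.endpoint s + Real.sin A.len • A.inward s := by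
  change _ = A.fromEnd s A.len
  cases s
  · rfl
  · rw [fromEnd_true, sub_self, curve_zero]; rfl

theorem norm_endpoint (A : GreatArc E) (s : Bool) : ‖A.endpoint s‖ = 1 := by
  cases s
  exacts [A.norm_p, A.norm_curve _]

theorem norm_inward (A : GreatArc E) (s : Bool) : ‖A.inward s‖ = 1 := by
  cases s
  · exact A.norm_u
  · have h := norm_cos_add_sin A.norm_p A.norm_u A.inner_p_u (A.len - Real.pi / 2)
    rw [Real.cos_sub_pi_div_two, Real.sin_sub_pi_div_two, neg_smul, ← sub_eq_add_neg] at h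
    exact h

theorem inner_endpoint_inward (A : GreatArc E) (s : Bool) :
    inner ℝ (A.endpoint s) (A.inward s) = 0 := by
  cases s
  · exact A.inner_p_u
  · simp only [endpoint, inward, curve, inner_add_left, inner_sub_right, inner_smul_left,
      inner_smul_right, real_inner_comm A.p A.u, A.inner_p_u, real_inner_self_eq_norm_sq,
      A.norm_p, A.norm_u]
    simp; ring

theorem norm_fromEnd (A : GreatArc E) (s : Bool) (t : ℝ) : ‖A.fromEnd s t‖ = 1 :=
  norm_cos_add_sin (A.norm_endpoint s) (A.norm_inward s) (A.inner_endpoint_inward s) t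

theorem fromEnd_mem_carrier (A : GreatArc E) (s : Bool) {t : ℝ} (ht : t ∈ Set.Icc 0 A.len) :
    A.fromEnd s t ∈ A.carrier := by
  cases s
  · exact ⟨t, ht, rfl⟩
  · rw [fromEnd_true]; exact ⟨_, ⟨by linarith [ht.2], by linarith [ht.1]⟩, rfl⟩

theorem fromEnd_injOn (A : GreatArc E) (s : Bool) :
    Set.InjOn (A.fromEnd s) (Set.Icc 0 A.len) := by
  intro t ht t' ht' h
  cases s
  · exact A.curve_injOn (A.mem_Ico_of_mem_Icc ht) (A.mem_Ico_of_mem_Icc ht') h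
  · rw [fromEnd_true, fromEnd_true] at h
    have := A.curve_injOn (A.mem_Ico_of_mem_Icc ⟨by linarith [ht.2], by linarith [ht.1]⟩)
      (A.mem_Ico_of_mem_Icc ⟨by linarith [ht'.2], by linarith [ht'.1]⟩) h
    linarith

theorem fromEnd_zero (A : GreatArc E) (s : Bool) : A.fromEnd s 0 = A.endpoint s := by
  simp [fromEnd]

theorem fromEnd_len (A : GreatArc E) (s : Bool) : A.fromEnd s A.len = A.endpoint (!s) :=
  (A.endpoint_eq s).symm

theorem carrier_eq_fromEnd (A : GreatArc E) (s : Bool) :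
    A.carrier = A.fromEnd s '' Set.Icc 0 A.len := by
  refine Set.Subset.antisymm ?_ (Set.image_subset_iff.2 fun t ht ↦ A.fromEnd_mem_carrier s ht)
  rintro _ ⟨t, ht, rfl⟩
  cases s
  · exact ⟨t, ht, rfl⟩
  · exact ⟨A.len - t, ⟨by linarith [ht.2], by linarith [ht.1]⟩, by
      rw [fromEnd_true]; congr 1; ring⟩

theorem endpoint_mem_carrier (A : GreatArc E) (s : Bool) : A.endpoint s ∈ A.carrier := by
  rw [← fromEnd_zero]; exact A.fromEnd_mem_carrier s ⟨le_rfl, A.len_pos.le⟩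

/-- The parametrization of an arc reaches the ends only at the ends of the interval. -/
theorem fromEnd_mem_range_endpoint (A : GreatArc E) (s : Bool) {t : ℝ}
    (ht : t ∈ Set.Icc 0 A.len) (h : A.fromEnd s t ∈ Set.range A.endpoint) :
    t = 0 ∨ t = A.len := by
  obtain ⟨s', hs'⟩ := h
  by_cases hss : s' = s
  · subst hss
    rw [← fromEnd_zero] at hs'
    exact Or.inl (A.fromEnd_injOn s' ⟨le_rfl, A.len_pos.le⟩ ht hs').symm
  · have : s' = !s := by cases s <;> cases s' <;> simp_all
    rw [this, ← fromEnd_len] at hs'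
    exact Or.inr (A.fromEnd_injOn s ⟨A.len_pos.le, le_rfl⟩ ht hs').symm

theorem endpoint_injective (A : GreatArc E) : Function.Injective A.endpoint := by
  have key : A.endpoint false ≠ A.endpoint true := fun h ↦ by
    have := A.fromEnd_injOn false ⟨le_rfl, A.len_pos.le⟩ ⟨A.len_pos.le, le_rfl⟩
      (by rw [fromEnd_zero, fromEnd_len]; exact h)
    exact A.len_pos.ne this
  intro s s' h
  cases s <;> cases s' <;> first | rfl | exact (key h).elim | exact (key h.symm).elim

theorem interior_subset (A : GreatArc E) : A.interior ⊆ A.carrier :=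
  Set.image_mono Set.Ioo_subset_Icc_self

theorem carrier_eq (A : GreatArc E) : A.carrier = A.interior ∪ Set.range A.endpoint := by
  refine Set.Subset.antisymm ?_ (Set.union_subset A.interior_subset ?_)
  · rintro _ ⟨t, ht, rfl⟩
    rcases ht.1.eq_or_lt with h | h
    · exact Or.inr ⟨false, by rw [← h, curve_zero]; rfl⟩
    rcases ht.2.eq_or_lt with h' | h'
    · exact Or.inr ⟨true, by rw [h']; rfl⟩
    · exact Or.inl ⟨t, ⟨h, h'⟩, rfl⟩
  · rintro _ ⟨s, rfl⟩
    exact A.endpoint_mem_carrier s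

theorem notMem_range_endpoint (A : GreatArc E) {x : E} (hx : x ∈ A.interior) :
    x ∉ Set.range A.endpoint := by
  obtain ⟨t, ht, rfl⟩ := hx
  intro h
  rcases A.fromEnd_mem_range_endpoint false (Set.Ioo_subset_Icc_self ht) h with h | h
  · exact ht.1.ne' h
  · exact ht.2.ne h

theorem isCompact_carrier (A : GreatArc E) : IsCompact A.carrier :=
  isCompact_Icc.image A.continuous_curve

theorem closure_interior (A : GreatArc E) : closure A.interior = A.carrier := by
  refine Set.Subset.antisymm (closure_minimal A.interior_subset A.isCompact_carrier.isClosed) ?_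
  rw [carrier, ← closure_Ioo A.len_pos.ne]
  exact image_closure_subset_closure_image A.continuous_curve

end GreatArc

/-! ### Nets of great circles and arcs -/

section Net

variable {E : Type*} [NormedAddCommGroup E] [InnerProductSpace ℝ E]

/-- `C` is a cone whose link is the net formed by the great circles `G k` and the arcs `A i`,
with the incidence and angle conditions of `SatisfiesNetCondition`. -/
structure IsNetCone {κ ι : Type*} (C : Set E) (G : κ → Set E) (A : ι → GreatArc E) : Prop where
  cone : IsConeAtOrigin C
  circle : ∀ k, IsGreatCircle (G k)
  link : C ∩ Metric.sphere 0 1 = (⋃ k, G k) ∪ (⋃ i, (A i).carrier)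
  circle_circle : ∀ k l, k ≠ l → Disjoint (G k) (G l)
  circle_arc : ∀ k i, Disjoint (G k) (A i).carrier
  arc_arc : ∀ i j, i ≠ j → (A i).carrier ∩ (A j).carrier ⊆
    Set.range (A i).endpoint ∩ Set.range (A j).endpoint
  three : ∀ e : ι × Bool,
    {f : ι × Bool | (A f.1).endpoint f.2 = (A e.1).endpoint e.2}.ncard = 3
  angle : ∀ e f : ι × Bool, e ≠ f → (A e.1).endpoint e.2 = (A f.1).endpoint f.2 →
    InnerProductGeometry.angle ((A e.1).inward e.2) ((A f.1).inward f.2) = 2 * Real.pi / 3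

/-- The points other than the origin whose direction lies in `S`. -/
def openCone (S : Set E) : Set E := {x | x ≠ 0 ∧ ‖x‖⁻¹ • x ∈ S}

/-- The cells of a net: its great circles and the interiors of its arcs. -/
def netCell {κ ι : Type*} (G : κ → Set E) (A : ι → GreatArc E) : κ ⊕ ι → Set E :=
  Sum.elim G fun i ↦ (A i).interior

/-- The closed cells of a net: its great circles and its arcs. -/
def netClosedCell {κ ι : Type*} (G : κ → Set E) (A : ι → GreatArc E) : κ ⊕ ι → Set E :=
  Sum.elim G fun i ↦ (A i).carrier

/-- The vertices of a net: the ends of its arcs. -/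
def netVertices {ι : Type*} (A : ι → GreatArc E) : Set E :=
  Set.range fun e : ι × Bool ↦ (A e.1).endpoint e.2

theorem openCone_mono {S T : Set E} (h : S ⊆ T) : openCone S ⊆ openCone T :=
  fun _ hx ↦ ⟨hx.1, h hx.2⟩

theorem mem_openCone_of_mem {S : Set E} {x : E} (hx : x ∈ S) (h1 : ‖x‖ = 1) : x ∈ openCone S :=
  ⟨fun h ↦ by simp [h] at h1, by simpa [h1] using hx⟩

theorem smul_mem_openCone {S : Set E} {x : E} (hx : x ∈ S) (h1 : ‖x‖ = 1) {r : ℝ} (hr : 0 < r) :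
    r • x ∈ openCone S := by
  refine ⟨smul_ne_zero hr.ne' fun h ↦ by simp [h] at h1, ?_⟩
  rw [norm_smul, h1, mul_one, smul_smul, Real.norm_of_nonneg hr.le, inv_mul_cancel₀ hr.ne',
    one_smul]
  exact hx

theorem exists_of_mem_openCone {S : Set E} {x : E} (hx : x ∈ openCone S) :
    ∃ v ∈ S, ‖v‖ = 1 ∧ x = ‖x‖ • v := by
  have hx0 := norm_ne_zero_iff.2 hx.1
  exact ⟨_, hx.2, by rw [norm_smul, norm_inv, norm_norm, inv_mul_cancel₀ hx0], by
    rw [smul_smul, mul_inv_cancel₀ hx0, one_smul]⟩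

theorem continuousOn_direction : ContinuousOn (fun x : E ↦ ‖x‖⁻¹ • x) {x | x ≠ 0} :=
  (continuous_norm.continuousOn.inv₀ fun _ hx ↦ norm_ne_zero_iff.2 hx).smul continuousOn_id

theorem isOpen_openCone_compl {S : Set E} (hS : IsClosed S) : IsOpen (openCone Sᶜ) :=
  continuousOn_direction.isOpen_inter_preimage isOpen_ne hS.isOpen_compl

theorem isPreconnected_openCone {S : Set E} (hS : IsPreconnected S) (h1 : ∀ x ∈ S, ‖x‖ = 1) :
    IsPreconnected (openCone S) := by
  have : openCone S = (fun q : ℝ × E ↦ q.1 • q.2) '' (Set.Ioi 0 ×ˢ S) := by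
    ext x
    constructor
    · intro hx
      obtain ⟨v, hv, -, h⟩ := exists_of_mem_openCone hx
      exact ⟨(‖x‖, v), ⟨norm_pos_iff.2 hx.1, hv⟩, h.symm⟩
    · rintro ⟨⟨r, v⟩, ⟨hr, hv⟩, rfl⟩
      exact smul_mem_openCone hv (h1 v hv) hr
  rw [this]
  exact (isPreconnected_Ioi.prod hS).image _ (by fun_prop)

theorem IsGreatCircle.isClosed {S : Set E} (h : IsGreatCircle S) : IsClosed S := by
  obtain ⟨P, hP, rfl⟩ := h
  have : FiniteDimensional ℝ P := Module.finite_of_finrank_pos (by omega)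
  exact P.closed_of_finiteDimensional.inter Metric.isClosed_sphere

theorem IsGreatCircle.exists_orthonormal {S : Set E} (h : IsGreatCircle S) :
    ∃ p u : E, ‖p‖ = 1 ∧ ‖u‖ = 1 ∧ inner ℝ p u = 0 ∧
      S = Set.range fun t : ℝ ↦ Real.cos t • p + Real.sin t • u := by
  obtain ⟨P, hP, rfl⟩ := h
  have : FiniteDimensional ℝ P := Module.finite_of_finrank_pos (by omega)
  let b := (stdOrthonormalBasis ℝ P).reindex (finCongr hP)
  have hp : ‖(b 0 : E)‖ = 1 := b.orthonormal.1 0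
  have hu : ‖(b 1 : E)‖ = 1 := b.orthonormal.1 1
  have h0 : inner ℝ (b 0 : E) (b 1) = 0 := b.orthonormal.2 (by decide : (0 : Fin 2) ≠ 1)
  refine ⟨b 0, b 1, hp, hu, h0, ?_⟩
  ext x
  constructor
  · rintro ⟨hxP, hx⟩
    have hx1 : ‖x‖ = 1 := by simpa using hx
    have hs := b.sum_repr ⟨x, hxP⟩
    have hn := b.sum_sq_norm_inner_right ⟨x, hxP⟩
    rw [Fin.sum_univ_two] at hs hn
    set α := b.repr ⟨x, hxP⟩ 0
    set β := b.repr ⟨x, hxP⟩ 1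
    have hs' : α • (b 0 : E) + β • (b 1 : E) = x := by
      simpa using congrArg Subtype.val hs
    have hαβ : α ^ 2 + β ^ 2 = 1 := by
      have : ‖x‖ ^ 2 = α ^ 2 + β ^ 2 := by
        rw [← hs', norm_add_sq_real, norm_smul, norm_smul, hp, hu, inner_smul_left,
          inner_smul_right, h0]
        simp
      rw [← this, hx1]; norm_num
    have hz : ‖(⟨α, β⟩ : ℂ)‖ = 1 := by
      rw [Complex.norm_def, Complex.normSq_apply, ← sq, ← sq]
      simp [hαβ]
    refine ⟨Complex.arg ⟨α, β⟩, ?_⟩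
    have hne : (⟨α, β⟩ : ℂ) ≠ 0 := fun h ↦ by rw [h] at hz; simp at hz
    simp only [Complex.cos_arg hne, Complex.sin_arg, hz, div_one]
    exact hs'
  · rintro ⟨t, rfl⟩
    exact ⟨P.add_mem (P.smul_mem _ (b 0).2) (P.smul_mem _ (b 1).2), by
      simpa using GreatArc.norm_cos_add_sin hp hu h0 t⟩

namespace IsNetCone

variable {κ ι : Type*} {C : Set E} {G : κ → Set E} {A : ι → GreatArc E}

theorem link_eq_closedCells (h : IsNetCone C G A) :
    C ∩ Metric.sphere 0 1 = ⋃ j, netClosedCell G A j := by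
  rw [h.link, Set.iUnion_sum]; rfl

theorem closedCell_subset (h : IsNetCone C G A) (j : κ ⊕ ι) : netClosedCell G A j ⊆ C := by
  have := Set.subset_iUnion (netClosedCell G A) j
  rw [← h.link_eq_closedCells] at this
  exact fun x hx ↦ (this hx).1

theorem norm_of_mem_closedCell (h : IsNetCone C G A) {j : κ ⊕ ι} {x : E}
    (hx : x ∈ netClosedCell G A j) : ‖x‖ = 1 := by
  have := Set.subset_iUnion (netClosedCell G A) j
  rw [← h.link_eq_closedCells] at this
  simpa using (this hx).2

theorem cell_subset (j : κ ⊕ ι) : netCell G A j ⊆ netClosedCell G A j := by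
  rcases j with k | i
  exacts [subset_rfl, (A i).interior_subset]

theorem norm_of_mem_cell (h : IsNetCone C G A) {j : κ ⊕ ι} {x : E}
    (hx : x ∈ netCell G A j) : ‖x‖ = 1 :=
  h.norm_of_mem_closedCell (cell_subset j hx)

theorem norm_of_mem_vertices {v : E} (hv : v ∈ netVertices A) : ‖v‖ = 1 := by
  obtain ⟨e, rfl⟩ := hv
  exact (A e.1).norm_endpoint e.2

theorem vertices_subset (h : IsNetCone C G A) : netVertices A ⊆ C := by
  rintro _ ⟨e, rfl⟩
  exact h.closedCell_subset (Sum.inr e.1) ((A e.1).endpoint_mem_carrier e.2)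

theorem isClosed_closedCell (h : IsNetCone C G A) (j : κ ⊕ ι) :
    IsClosed (netClosedCell G A j) := by
  rcases j with k | i
  exacts [(h.circle k).isClosed, (A i).isCompact_carrier.isClosed]

theorem eq_of_mem_cell (h : IsNetCone C G A) {j j' : κ ⊕ ι} {x : E}
    (hx : x ∈ netCell G A j) (hx' : x ∈ netClosedCell G A j') : j = j' := by
  by_contra hne
  rcases j with k | i <;> rcases j' with k' | i'
  · exact Set.disjoint_left.1 (h.circle_circle k k' fun hk ↦ hne (by rw [hk])) hx hx'
  · exact Set.disjoint_left.1 (h.circle_arc k i') hx hx'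
  · exact Set.disjoint_left.1 (h.circle_arc k' i) hx' ((A i).interior_subset hx)
  · exact (A i).notMem_range_endpoint hx
      (h.arc_arc i i' (fun hk ↦ hne (by rw [hk])) ⟨(A i).interior_subset hx, hx'⟩).1

theorem exists_of_vertex_mem (h : IsNetCone C G A) {v : E} (hv : v ∈ netVertices A) {j : κ ⊕ ι}
    (hx : v ∈ netClosedCell G A j) : ∃ i s, j = Sum.inr i ∧ v = (A i).endpoint s := by
  obtain ⟨e, rfl⟩ := hv
  rcases j with k | i
  · exact (Set.disjoint_left.1 (h.circle_arc k e.1) hx ((A e.1).endpoint_mem_carrier e.2)).elim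
  · by_cases hi : i = e.1
    · exact ⟨i, e.2, rfl, by rw [hi]⟩
    · obtain ⟨s, hs⟩ := (h.arc_arc i e.1 hi ⟨hx, (A e.1).endpoint_mem_carrier e.2⟩).1
      exact ⟨i, s, rfl, hs.symm⟩

theorem direction_mem (h : IsNetCone C G A) {x : E} (hx : x ∈ C) (hx0 : x ≠ 0) :
    ∃ j, ‖x‖⁻¹ • x ∈ netClosedCell G A j := by
  have : ‖x‖⁻¹ • x ∈ C ∩ Metric.sphere 0 1 := by
    refine ⟨h.cone x hx _ (inv_nonneg.2 (norm_nonneg _)), ?_⟩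
    rw [mem_sphere_zero_iff_norm, norm_smul, norm_inv, norm_norm,
      inv_mul_cancel₀ (norm_ne_zero_iff.2 hx0)]
  rw [h.link_eq_closedCells] at this
  exact Set.mem_iUnion.1 this

theorem direction_mem_cell_or (h : IsNetCone C G A) {x : E} (hx : x ∈ C) (hx0 : x ≠ 0) :
    (∃ j, ‖x‖⁻¹ • x ∈ netCell G A j) ∨ ‖x‖⁻¹ • x ∈ netVertices A := by
  obtain ⟨j, hj⟩ := h.direction_mem hx hx0
  rcases j with k | i
  · exact Or.inl ⟨Sum.inl k, hj⟩
  · have hj' : ‖x‖⁻¹ • x ∈ (A i).carrier := hj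
    rw [GreatArc.carrier_eq] at hj'
    rcases hj' with hj' | ⟨s, hs⟩
    · exact Or.inl ⟨Sum.inr i, hj'⟩
    · exact Or.inr ⟨(i, s), hs⟩

theorem openCone_closedCell_subset (h : IsNetCone C G A) (j : κ ⊕ ι) :
    openCone (netClosedCell G A j) ⊆ C := fun x hx ↦ by
  obtain ⟨v, hv, -, hxv⟩ := exists_of_mem_openCone hx
  rw [hxv]
  exact h.cone v (h.closedCell_subset j hv) _ (norm_nonneg _)

theorem isPreconnected_cell (h : IsNetCone C G A) (j : κ ⊕ ι) :
    IsPreconnected (netCell G A j) := by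
  rcases j with k | i
  · obtain ⟨p, u, -, -, -, hS⟩ := (h.circle k).exists_orthonormal
    change IsPreconnected (G k)
    rw [hS]
    exact isPreconnected_range (by fun_prop)
  · exact isPreconnected_Ioo.image _ (A i).continuous_curve.continuousOn

theorem cell_nonempty (h : IsNetCone C G A) (j : κ ⊕ ι) : (netCell G A j).Nonempty := by
  rcases j with k | i
  · obtain ⟨p, u, -, -, -, hS⟩ := (h.circle k).exists_orthonormal
    change (G k).Nonempty
    rw [hS]
    exact Set.range_nonempty _
  · exact ⟨_, _, ⟨half_pos (A i).len_pos, half_lt_self (A i).len_pos⟩, rfl⟩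

end IsNetCone

end Net

/-! ### Planar points of a net cone -/

section Planar

variable {E : Type*} [NormedAddCommGroup E] [InnerProductSpace ℝ E]

/-- Some neighbourhood of `z` in `C` embeds in the plane. The embedding is only required to be
continuous and injective, which makes the notion invariant under homeomorphisms. -/
def PlanarAt (C : Set E) (z : E) : Prop :=
  ∃ U ∈ nhdsWithin z C, ∃ f : E → ℂ, ContinuousOn f U ∧ Set.InjOn f U

namespace IsNetCone

variable {κ ι : Type*} {C : Set E} {G : κ → Set E} {A : ι → GreatArc E}

theorem exists_orthonormal_of_closedCell (h : IsNetCone C G A) (j : κ ⊕ ι) :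
    ∃ p u : E, ‖p‖ = 1 ∧ ‖u‖ = 1 ∧ inner ℝ p u = 0 ∧
      netClosedCell G A j ⊆ Set.range fun t : ℝ ↦ Real.cos t • p + Real.sin t • u := by
  rcases j with k | i
  · obtain ⟨p, u, hp, hu, h0, hS⟩ := (h.circle k).exists_orthonormal
    exact ⟨p, u, hp, hu, h0, hS.subset⟩
  · exact ⟨(A i).p, (A i).u, (A i).norm_p, (A i).norm_u, (A i).inner_p_u,
      Set.image_subset_range _ _⟩

/-- The part of the cone away from the other closed cells. -/
theorem isOpen_away [Finite κ] [Finite ι] (h : IsNetCone C G A) (j : κ ⊕ ι) :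
    IsOpen (openCone (⋃ j' ∈ {j' | j' ≠ j}, netClosedCell G A j')ᶜ) :=
  isOpen_openCone_compl ((Set.toFinite _).isClosed_biUnion fun j' _ ↦ h.isClosed_closedCell j')

theorem cell_subset_away (h : IsNetCone C G A) (j : κ ⊕ ι) :
    netCell G A j ⊆ (⋃ j' ∈ {j' | j' ≠ j}, netClosedCell G A j')ᶜ := by
  intro x hx hx'
  simp only [Set.mem_iUnion] at hx'
  obtain ⟨j', hj', hx'⟩ := hx'
  exact hj' (h.eq_of_mem_cell hx hx').symm

/-- Away from the other closed cells, the cone over a cell lies in the plane of that cell. -/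
theorem planarAt_of_mem_cell [Finite κ] [Finite ι] (h : IsNetCone C G A) {j : κ ⊕ ι} {z : E}
    (hz : z ∈ openCone (netCell G A j)) : PlanarAt C z := by
  obtain ⟨p, u, hp, hu, h0, hsub⟩ := h.exists_orthonormal_of_closedCell j
  refine ⟨C ∩ openCone (⋃ j' ∈ {j' | j' ≠ j}, netClosedCell G A j')ᶜ, ?_,
    fun x ↦ ⟨inner ℝ p x, inner ℝ u x⟩, ?_, ?_⟩
  · exact inter_mem_nhdsWithin _ ((h.isOpen_away j).mem_nhds
      (openCone_mono (h.cell_subset_away j) hz))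
  · have : (fun x : E ↦ (⟨inner ℝ p x, inner ℝ u x⟩ : ℂ)) =
        fun x ↦ ((inner ℝ p x : ℝ) : ℂ) + ((inner ℝ u x : ℝ) : ℂ) * Complex.I := by
      ext x; exact Complex.mk_eq_add_mul_I _ _
    rw [this]
    fun_prop
  · have key : ∀ x ∈ C ∩ openCone (⋃ j' ∈ {j' | j' ≠ j}, netClosedCell G A j')ᶜ,
        x = inner ℝ p x • p + inner ℝ u x • u := by
      rintro x ⟨hxC, hx⟩
      obtain ⟨j', hj'⟩ := h.direction_mem hxC hx.1
      have : j' = j := by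
        by_contra hne
        exact hx.2 (Set.mem_biUnion hne hj')
      subst this
      obtain ⟨t, ht⟩ := hsub hj'
      have hx' : x = ‖x‖ • (Real.cos t • p + Real.sin t • u) := by
        simp only at ht
        rw [ht, smul_smul, mul_inv_cancel₀ (norm_ne_zero_iff.2 hx.1), one_smul]
      rw [hx']
      generalize ‖x‖ = r
      simp only [inner_smul_right, inner_add_right, h0, real_inner_comm p u,
        real_inner_self_eq_norm_sq, hp, hu]
      simp [smul_smul]
    intro x hx y hy hxy
    have h1 : inner ℝ p x = inner ℝ p y := (Complex.ext_iff.1 hxy).1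
    have h2 : inner ℝ u x = inner ℝ u y := (Complex.ext_iff.1 hxy).2
    rw [key x hx, key y hy, h1, h2]

/-- Near a ray over a vertex, the cone contains three half discs glued along a segment of the ray,
one in each of the three sheets that meet there. -/
theorem not_planarAt_of_mem_vertices (h : IsNetCone C G A) {z : E}
    (hz : z ∈ openCone (netVertices A)) : ¬ PlanarAt C z := by
  rintro ⟨U, hU, f, hfc, hfi⟩
  obtain ⟨v, ⟨e₀, rfl⟩, hv1, hzv⟩ := exists_of_mem_openCone hz
  have hρ : 0 < ‖z‖ := norm_pos_iff.2 hz.1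
  generalize ‖z‖ = ρ at hzv hρ
  obtain ⟨x₀, x₁, x₂, h01, h02, h12, h3⟩ := Set.ncard_eq_three.1 (h.three e₀)
  let e : Fin 3 → ι × Bool := ![x₀, x₁, x₂]
  have he : ∀ k, (A (e k).1).endpoint (e k).2 = (A e₀.1).endpoint e₀.2 := by
    have : ∀ k, e k ∈ ({x₀, x₁, x₂} : Set (ι × Bool)) := by
      intro k; fin_cases k <;> simp [e]
    intro k
    have := this k
    rw [← h3] at this
    exact this
  have hei : Function.Injective e := by
    intro k l hkl
    fin_cases k <;> fin_cases l <;> simp_all [e]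
  set v := (A e₀.1).endpoint e₀.2
  have hidx : ∀ k l, k ≠ l → (e k).1 ≠ (e l).1 := by
    intro k l hkl hi
    have h1 := he k
    rw [hi, ← he l] at h1
    exact hkl (hei (Prod.ext hi ((A (e l).1).endpoint_injective h1)))
  obtain ⟨O, hO, hzO, hOU⟩ := mem_nhdsWithin.1 hU
  -- the sheet `k` in coordinates: distance from the edge along the arc, and radial displacement
  let s : Fin 3 → ℂ → E := fun k ζ ↦ (ρ + ζ.im) • (A (e k).1).fromEnd (e k).2 ζ.re
  have hs : ∀ k, Continuous (s k) := by
    intro k; simp only [s, GreatArc.fromEnd]; fun_prop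
  have hs0 : ∀ k, s k 0 = z := by
    intro k; simp [s, GreatArc.fromEnd_zero, he, hzv, v]
  have hev : ∀ᶠ ζ : ℂ in nhds 0, ∀ k, s k ζ ∈ O ∧ ζ.re < (A (e k).1).len ∧ -ρ < ζ.im := by
    refine Filter.eventually_all.2 fun k ↦ ?_
    refine ((hs k).continuousAt.eventually (by rw [hs0]; exact hO.mem_nhds hzO)).and
      (Filter.Eventually.and ?_ ?_)
    · exact Complex.continuous_re.continuousAt.eventually
        (gt_mem_nhds (by simpa using (A (e k).1).len_pos))
    · exact Complex.continuous_im.continuousAt.eventually (lt_mem_nhds (by simpa using hρ))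
  obtain ⟨r, hr, hball⟩ := Metric.eventually_nhds_iff.1 hev
  let ε : ℝ := r / 2
  have hε : 0 < ε := half_pos hr
  have hin : ∀ ζ ∈ halfDisc, ∀ k, s k (ε * ζ) ∈ O ∧ ε * ζ.re < (A (e k).1).len ∧
      0 < ρ + ε * ζ.im ∧ 0 ≤ ε * ζ.re := by
    intro ζ hζ k
    have hd : dist ((ε : ℂ) * ζ) 0 < r := by
      rw [dist_zero_right, norm_mul, Complex.norm_real, Real.norm_of_nonneg hε.le]
      have : ‖ζ‖ ≤ 1 := by simpa using hζ.1
      have : ε * ‖ζ‖ ≤ ε * 1 := by gcongr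
      have : ε < r := half_lt_self hr
      linarith
    obtain ⟨a1, a2, a3⟩ := hball hd k
    simp only [Complex.re_ofReal_mul, Complex.im_ofReal_mul] at a2 a3
    exact ⟨a1, a2, by linarith, mul_nonneg hε.le hζ.2⟩
  have hsU : ∀ ζ ∈ halfDisc, ∀ k, s k (ε * ζ) ∈ U := by
    intro ζ hζ k
    obtain ⟨a1, a2, a3, a4⟩ := hin ζ hζ k
    refine hOU ⟨a1, h.cone _ (h.closedCell_subset (Sum.inr (e k).1)
      ((A (e k).1).fromEnd_mem_carrier _ ?_)) _ ?_⟩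
    · simp only [Complex.re_ofReal_mul]; exact ⟨a4, a2.le⟩
    · simp only [Complex.im_ofReal_mul]; exact a3.le
  refine false_of_three_halfDiscs (fun k ζ ↦ f (s k (ε * ζ))) ?_ ?_ ?_
  · intro k
    exact hfc.comp ((hs k).comp (by fun_prop)).continuousOn fun ζ hζ ↦ hsU ζ hζ k
  · intro k l ζ hζ h0
    simp only [s, Complex.re_ofReal_mul, h0, mul_zero, GreatArc.fromEnd_zero, he]
  · intro k l ζ hζ ξ hξ hf
    have heq := hfi (hsU ζ hζ k) (hsU ξ hξ l) hf
    obtain ⟨-, a2, a3, a4⟩ := hin ζ hζ k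
    obtain ⟨-, b2, b3, b4⟩ := hin ξ hξ l
    simp only [s, Complex.re_ofReal_mul, Complex.im_ofReal_mul] at heq
    have him : ρ + ε * ζ.im = ρ + ε * ξ.im := by
      have := congrArg norm heq
      rwa [norm_smul, norm_smul, GreatArc.norm_fromEnd, GreatArc.norm_fromEnd, mul_one, mul_one,
        Real.norm_of_nonneg a3.le, Real.norm_of_nonneg b3.le] at this
    rw [← him] at heq
    have hfe := smul_right_injective E a3.ne' heq
    have him' : ζ.im = ξ.im := by
      have : ε * ζ.im = ε * ξ.im := by linarith
      exact mul_left_cancel₀ hε.ne' this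
    by_cases hkl : k = l
    · subst hkl
      have := (A (e k).1).fromEnd_injOn _ ⟨a4, a2.le⟩ ⟨b4, b2.le⟩ hfe
      exact ⟨Complex.ext (mul_left_cancel₀ hε.ne' this) him', Or.inl rfl⟩
    · have hmem := h.arc_arc _ _ (hidx k l hkl)
        ⟨(A (e k).1).fromEnd_mem_carrier (e k).2 ⟨a4, a2.le⟩, by
          rw [hfe]; exact (A (e l).1).fromEnd_mem_carrier (e l).2 ⟨b4, b2.le⟩⟩
      have c1 := ((A (e k).1).fromEnd_mem_range_endpoint _ ⟨a4, a2.le⟩ hmem.1).resolve_right a2.ne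
      have c2 := ((A (e l).1).fromEnd_mem_range_endpoint _ ⟨b4, b2.le⟩
        (by rw [← hfe]; exact hmem.2)).resolve_right b2.ne
      have d1 : ζ.re = 0 := (mul_eq_zero.1 c1).resolve_left hε.ne'
      have d2 : ξ.re = 0 := (mul_eq_zero.1 c2).resolve_left hε.ne'
      exact ⟨Complex.ext (d1.trans d2.symm) him', Or.inr d1⟩

end IsNetCone

end Planar

/-! ### Homeomorphisms between net cones -/

section Homeo

variable {E : Type*} [NormedAddCommGroup E]

/-- The points of `C` that are not planar. -/
def nonplanarSet (C : Set E) : Set E := {x ∈ C | ¬ PlanarAt C x}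

/-- `f` and `g` restrict to mutually inverse homeomorphisms between `C` and `C'`. -/
structure HomeoOn (f g : E → E) (C C' : Set E) : Prop where
  cont : ContinuousOn f C
  cont' : ContinuousOn g C'
  maps : Set.MapsTo f C C'
  maps' : Set.MapsTo g C' C
  left_inv : ∀ x ∈ C, g (f x) = x
  right_inv : ∀ x ∈ C', f (g x) = x

namespace HomeoOn

variable {f g : E → E} {C C' : Set E}

theorem symm (φ : HomeoOn f g C C') : HomeoOn g f C' C :=
  ⟨φ.cont', φ.cont, φ.maps', φ.maps, φ.right_inv, φ.left_inv⟩

theorem of_homeomorph (φ : C ≃ₜ C') : ∃ f g, HomeoOn f g C C' := by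
  classical
  have key : ∀ {D D' : Set E} (ψ : D ≃ₜ D'), ∃ f : E → E, ContinuousOn f D ∧
      ∀ x : D, f x = ψ x := by
    intro D D' ψ
    refine ⟨fun x ↦ if hx : x ∈ D then ψ ⟨x, hx⟩ else 0, ?_, fun x ↦ by simp⟩
    rw [continuousOn_iff_continuous_domRestrict]
    have : D.domRestrict (fun x ↦ if hx : x ∈ D then (ψ ⟨x, hx⟩ : E) else 0) =
        fun x ↦ (ψ x : E) := by
      ext x; simp [Set.domRestrict]
    rw [this]
    fun_prop
  obtain ⟨f, hf, hfφ⟩ := key φ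
  obtain ⟨g, hg, hgφ⟩ := key φ.symm
  refine ⟨f, g, hf, hg, fun x hx ↦ ?_, fun x hx ↦ ?_, fun x hx ↦ ?_, fun x hx ↦ ?_⟩
  · rw [hfφ ⟨x, hx⟩]; exact (φ _).2
  · rw [hgφ ⟨x, hx⟩]; exact (φ.symm _).2
  · rw [hfφ ⟨x, hx⟩, hgφ, φ.symm_apply_apply]
  · rw [hgφ ⟨x, hx⟩, hfφ, φ.apply_symm_apply]

theorem planarAt (φ : HomeoOn f g C C') {z : E} (hz : z ∈ C) (h : PlanarAt C z) :
    PlanarAt C' (f z) := by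
  obtain ⟨U, hU, F, hF, hFi⟩ := h
  have ht : Filter.Tendsto g (nhdsWithin (f z) C') (nhdsWithin z C) := by
    have := (φ.cont' (f z) (φ.maps hz)).tendsto_nhdsWithin φ.maps'
    rwa [φ.left_inv z hz] at this
  refine ⟨g ⁻¹' U ∩ C', Filter.inter_mem (ht hU) self_mem_nhdsWithin, F ∘ g,
    hF.comp (φ.cont'.mono Set.inter_subset_right) fun x hx ↦ hx.1, ?_⟩
  intro x hx y hy hxy
  have := hFi hx.1 hy.1 hxy
  rw [← φ.right_inv x hx.2, ← φ.right_inv y hy.2, this]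

theorem mem_nonplanarSet (φ : HomeoOn f g C C') {z : E} (hz : z ∈ nonplanarSet C) :
    f z ∈ nonplanarSet C' :=
  ⟨φ.maps hz.1, fun h ↦ hz.2 (by simpa [φ.left_inv z hz.1] using φ.symm.planarAt (φ.maps hz.1) h)⟩

theorem mem_closure_nonplanarSet (φ : HomeoOn f g C C') {z : E} (hz : z ∈ C)
    (hz' : z ∈ closure (nonplanarSet C)) : f z ∈ closure (nonplanarSet C') :=
  have hsub : f '' nonplanarSet C ⊆ nonplanarSet C' :=
    Set.image_subset_iff.2 fun _ hx ↦ φ.mem_nonplanarSet hx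
  have hC : nonplanarSet C ⊆ C := fun _ hx ↦ hx.1
  closure_mono hsub (((φ.cont z hz).mono hC).mem_closure_image hz')

end HomeoOn

end Homeo

section NetHomeo

variable {E : Type*} [NormedAddCommGroup E] [InnerProductSpace ℝ E]

/-- The rays of a cone over finitely many directions are its components. -/
theorem direction_eq_of_isPreconnected {V P : Set E} (hV : V.Finite) (hP : IsPreconnected P)
    (hPV : P ⊆ openCone V) {x y : E} (hx : x ∈ P) (hy : y ∈ P) :
    ‖x‖⁻¹ • x = ‖y‖⁻¹ • y := by
  have h1 := hP.image _ (continuousOn_direction.mono fun z hz ↦ (hPV hz).1)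
  exact hV.countable.isTotallyDisconnected _ (Set.image_subset_iff.2 fun z hz ↦ (hPV hz).2) h1
    (Set.mem_image_of_mem _ hx) (Set.mem_image_of_mem _ hy)

namespace IsNetCone

variable {κ ι κ' ι' : Type*} {C C' : Set E} {G : κ → Set E} {A : ι → GreatArc E}
  {G' : κ' → Set E} {A' : ι' → GreatArc E} {f g : E → E}

theorem finite_vertices [Finite ι] : (netVertices A).Finite := Set.finite_range _

theorem openCone_vertices_subset (h : IsNetCone C G A) : openCone (netVertices A) ⊆ C := by
  intro x hx
  obtain ⟨v, hv, -, hxv⟩ := exists_of_mem_openCone hx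
  rw [hxv]
  exact h.cone v (h.vertices_subset hv) _ (norm_nonneg _)

theorem openCone_vertices_subset_nonplanarSet (h : IsNetCone C G A) :
    openCone (netVertices A) ⊆ nonplanarSet C :=
  fun _ hx ↦ ⟨h.openCone_vertices_subset hx, h.not_planarAt_of_mem_vertices hx⟩

theorem mem_openCone_of_not_planarAt [Finite κ] [Finite ι] (h : IsNetCone C G A) {x : E}
    (hx : x ∈ C) (hx0 : x ≠ 0) (hp : ¬ PlanarAt C x) : x ∈ openCone (netVertices A) := by
  rcases h.direction_mem_cell_or hx hx0 with ⟨j, hj⟩ | hv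
  · exact (hp (h.planarAt_of_mem_cell ⟨hx0, hj⟩)).elim
  · exact ⟨hx0, hv⟩

/-- Apart from the apex, the closure of the nonplanar set consists of the rays over vertices. It is
used instead of the nonplanar set because planarity at the apex is left undecided. -/
theorem mem_openCone_of_mem_closure [Finite κ] [Finite ι] (h : IsNetCone C G A) {x : E}
    (hx0 : x ≠ 0) (hx : x ∈ closure (nonplanarSet C)) : x ∈ openCone (netVertices A) := by
  by_contra hn
  have hO := isOpen_openCone_compl (E := E) (finite_vertices (A := A)).isClosed
  obtain ⟨y, hy1, hy2⟩ := mem_closure_iff.1 hx _ hO ⟨hx0, fun hv ↦ hn ⟨hx0, hv⟩⟩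
  exact hy1.2 (h.mem_openCone_of_not_planarAt hy2.1 hy1.1 hy2.2).2

theorem zero_mem_closure (h : IsNetCone C G A) {v : E} (hv : v ∈ netVertices A) :
    (0 : E) ∈ closure (nonplanarSet C) := by
  have h1 : Filter.Tendsto (fun r : ℝ ↦ r • v) (nhdsWithin 0 (Set.Ioi 0)) (nhds 0) := by
    have : Continuous fun r : ℝ ↦ r • v := by fun_prop
    have := this.tendsto 0
    rw [zero_smul] at this
    exact this.mono_left nhdsWithin_le_nhds
  refine mem_closure_of_tendsto h1 (eventually_mem_nhdsWithin.mono fun r hr ↦ ?_)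
  exact h.openCone_vertices_subset_nonplanarSet (smul_mem_openCone hv (norm_of_mem_vertices hv) hr)

theorem zero_mem (h : IsNetCone C G A) {x : E} (hx : x ∈ C) : (0 : E) ∈ C := by
  simpa using h.cone x hx 0 le_rfl

/-- A homeomorphism to a net cone with at least three vertices matches the apices: the closure of
the nonplanar set falls into at most two pieces when a point other than the apex is removed. -/
theorem map_zero [Finite κ] [Finite ι] [Finite κ'] [Finite ι'] (h : IsNetCone C G A)
    (h' : IsNetCone C' G' A') (φ : HomeoOn f g C C') {w : Fin 3 → E} (hw : Function.Injective w)
    (hwV : ∀ k, w k ∈ netVertices A') : g 0 = 0 := by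
  have h0C' : (0 : E) ∈ C' := h'.zero_mem (h'.vertices_subset (hwV 0))
  have h0C := φ.maps' h0C'
  by_contra hz0
  have hzV := h.mem_openCone_of_mem_closure hz0
    (φ.symm.mem_closure_nonplanarSet h0C' (h'.zero_mem_closure (hwV 0)))
  obtain ⟨v, hv, hv1, hzv⟩ := exists_of_mem_openCone hzV
  have hρ : 0 < ‖g 0‖ := norm_pos_iff.2 hz0
  set ρ := ‖g 0‖
  let T : Set E := C ∩ closure (nonplanarSet C)
  -- the part of the ray through `g 0` beyond `g 0`; the rest of `T \ {g 0}` is star-shaped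
  let T₁ : Set E := (fun r : ℝ ↦ r • v) '' Set.Ioi ρ
  have hT₁ : IsPreconnected T₁ := isPreconnected_Ioi.image _ (by fun_prop)
  have hT₁T : T₁ ⊆ T \ {g 0} := by
    rintro _ ⟨r, hr, rfl⟩
    have hm := h.openCone_vertices_subset_nonplanarSet
      (smul_mem_openCone hv hv1 (hρ.trans hr))
    refine ⟨⟨hm.1, subset_closure hm⟩, fun heq ↦ ?_⟩
    have h1 : r • v = ρ • v := heq.trans hzv
    have h2 := congrArg norm h1
    rw [norm_smul, norm_smul, hv1, mul_one, mul_one, Real.norm_of_nonneg hρ.le,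
      Real.norm_of_nonneg (hρ.trans hr).le] at h2
    exact (ne_of_gt hr) h2
  have hT₂ : IsPreconnected ((T \ {g 0}) \ T₁) := by
    have hstar : StarConvex ℝ 0 ((T \ {g 0}) \ T₁) := by
      rw [starConvex_zero_iff]
      rintro x ⟨⟨⟨hxC, hx⟩, hxz⟩, hxT⟩ t ht0 ht1
      rcases eq_or_ne x 0 with hx0 | hx0
      · subst hx0; rw [smul_zero]; exact ⟨⟨⟨hxC, hx⟩, hxz⟩, hxT⟩
      obtain ⟨u, hu, hu1, hxu⟩ := exists_of_mem_openCone (h.mem_openCone_of_mem_closure hx0 hx)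
      have hn : 0 < ‖x‖ := norm_pos_iff.2 hx0
      have key : ∀ r : ℝ, ρ ≤ r → t • x ≠ r • v := by
        intro r hr heq
        have h1 := congrArg norm heq
        have hr0 : 0 ≤ r := hρ.le.trans hr
        rw [norm_smul, norm_smul, hv1, mul_one, Real.norm_of_nonneg ht0,
          Real.norm_of_nonneg hr0] at h1
        have hle : ρ ≤ ‖x‖ := by nlinarith
        have huv : x = ‖x‖ • v := by
          have ht : 0 < t := by
            rcases ht0.eq_or_lt with h3 | h3
            · rw [← h3] at h1; linarith
            · exact h3
          have h4 : t • x = t • (‖x‖ • v) := by rw [heq, smul_smul, h1]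
          exact smul_right_injective E ht.ne' h4
        rcases hle.eq_or_lt with h3 | h3
        · exact hxz (by rw [Set.mem_singleton_iff, huv, ← h3, ← hzv])
        · exact hxT ⟨‖x‖, h3, huv.symm⟩
      refine ⟨⟨⟨h.cone x hxC t ht0, ?_⟩, ?_⟩, ?_⟩
      · rcases ht0.eq_or_lt with h3 | h3
        · rw [← h3, zero_smul]; exact h.zero_mem_closure hv
        · rw [hxu, smul_smul]
          exact subset_closure (h.openCone_vertices_subset_nonplanarSet
            (smul_mem_openCone hu hu1 (mul_pos h3 hn)))
      · exact fun heq ↦ key ρ le_rfl (heq.trans hzv)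
      · rintro ⟨r, hr, heq⟩
        exact key r (le_of_lt hr) heq.symm
    refine (hstar.isPathConnected ?_).isConnected.isPreconnected
    refine ⟨⟨⟨h.zero_mem h0C, h.zero_mem_closure hv⟩, fun heq ↦ hz0 heq.symm⟩, ?_⟩
    rintro ⟨r, hr, heq⟩
    have := congrArg norm heq
    simp only [norm_smul, hv1, mul_one, norm_zero, Real.norm_of_nonneg (hρ.trans hr).le] at this
    exact (hρ.trans hr).ne' this
  -- `f` maps a connected part of `T \ {g 0}` into a single ray
  have hsep : ∀ P ⊆ T \ {g 0}, IsPreconnected P → ∀ k l, g (w k) ∈ P → g (w l) ∈ P → k = l := by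
    intro P hPT hP k l hk hl
    have hfP : f '' P ⊆ openCone (netVertices A') := by
      rintro _ ⟨x, hx, rfl⟩
      refine h'.mem_openCone_of_mem_closure (fun h0 ↦ ?_)
        (φ.mem_closure_nonplanarSet (hPT hx).1.1 (hPT hx).1.2)
      refine (hPT hx).2 ?_
      rw [Set.mem_singleton_iff, ← h0, φ.left_inv x (hPT hx).1.1]
    have hd := direction_eq_of_isPreconnected finite_vertices
      (hP.image f (φ.cont.mono fun x hx ↦ (hPT hx).1.1)) hfP
      (Set.mem_image_of_mem f hk) (Set.mem_image_of_mem f hl)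
    rw [φ.right_inv _ (h'.vertices_subset (hwV k)), φ.right_inv _ (h'.vertices_subset (hwV l)),
      norm_of_mem_vertices (hwV k), norm_of_mem_vertices (hwV l)] at hd
    exact hw (by simpa using hd)
  have hgw : ∀ k, g (w k) ∈ T \ {g 0} := by
    intro k
    have hm := h'.openCone_vertices_subset_nonplanarSet
      (mem_openCone_of_mem (hwV k) (norm_of_mem_vertices (hwV k)))
    refine ⟨⟨φ.maps' hm.1, subset_closure (φ.symm.mem_nonplanarSet hm)⟩, fun heq ↦ ?_⟩
    have := congrArg f heq
    rw [φ.right_inv _ hm.1, φ.right_inv _ h0C'] at this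
    have h1 := norm_of_mem_vertices (hwV k)
    rw [this, norm_zero] at h1
    exact zero_ne_one h1
  obtain ⟨k, l, hkl, hiff⟩ := Fintype.exists_ne_map_eq_of_card_lt
    (fun k : Fin 3 ↦ (g (w k) ∈ T₁ : Prop)) (by simp)
  by_cases hk : g (w k) ∈ T₁
  · exact hkl (hsep T₁ hT₁T hT₁ k l hk (hiff.mp hk))
  · exact hkl (hsep _ Set.sdiff_subset hT₂ k l ⟨hgw k, hk⟩ ⟨hgw l, fun hl ↦ hk (hiff.mpr hl)⟩)

/-- A homeomorphism between net cones that fixes the apex maps rays over vertices to rays over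
vertices and cones over cells to cones over cells, and respects incidence. -/
theorem exists_map_vertices_cells [Finite κ] [Finite ι] [Finite κ'] [Finite ι']
    (h : IsNetCone C G A) (h' : IsNetCone C' G' A') (φ : HomeoOn f g C C')
    (hg0 : g 0 = 0) :
    ∃ (τ : E → E) (σ : κ ⊕ ι → κ' ⊕ ι'),
      (∀ v ∈ netVertices A, τ v ∈ netVertices A' ∧ ∀ x ∈ openCone {v}, f x ∈ openCone {τ v}) ∧
      (∀ j, ∀ x ∈ openCone (netCell G A j), f x ∈ openCone (netCell G' A' (σ j))) ∧
      ∀ v ∈ netVertices A, ∀ j, v ∈ netClosedCell G A j → τ v ∈ netClosedCell G' A' (σ j) := by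
  have hne : ∀ x ∈ C, x ≠ 0 → f x ≠ 0 := fun x hx hx0 h0 ↦ hx0 (by
    rw [← φ.left_inv x hx, h0, hg0])
  have hfV : ∀ x ∈ openCone (netVertices A), f x ∈ openCone (netVertices A') := fun x hx ↦ by
    have hm := φ.mem_nonplanarSet (h.openCone_vertices_subset_nonplanarSet hx)
    exact h'.mem_openCone_of_not_planarAt hm.1
      (hne x (h.openCone_vertices_subset hx) hx.1) hm.2
  have hτ : ∀ v ∈ netVertices A, ∀ x ∈ openCone {v}, f x ∈ openCone {‖f v‖⁻¹ • f v} := by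
    intro v hv x hx
    have hv1 := norm_of_mem_vertices hv
    have hsub : openCone {v} ⊆ openCone (netVertices A) :=
      openCone_mono (Set.singleton_subset_iff.2 hv)
    have hP : IsPreconnected (openCone {v}) :=
      isPreconnected_openCone isPreconnected_singleton (by simpa using hv1)
    have hd := direction_eq_of_isPreconnected finite_vertices
      (hP.image f (φ.cont.mono (hsub.trans h.openCone_vertices_subset)))
      (Set.image_subset_iff.2 fun y hy ↦ hfV y (hsub hy))
      (Set.mem_image_of_mem f hx) (Set.mem_image_of_mem f (mem_openCone_of_mem rfl hv1))
    exact ⟨(hfV x (hsub hx)).1, hd⟩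
  have hσ : ∀ j, ∃ j', ∀ x ∈ openCone (netCell G A j), f x ∈ openCone (netCell G' A' j') := by
    intro j
    have hsubC : openCone (netCell G A j) ⊆ C :=
      (openCone_mono (cell_subset j)).trans (h.openCone_closedCell_subset j)
    have hcell : ∀ x ∈ openCone (netCell G A j), ∃ j', f x ∈ openCone (netCell G' A' j') := by
      intro x hx
      have hxC := hsubC hx
      have hx0 := hne x hxC hx.1
      rcases h'.direction_mem_cell_or (φ.maps hxC) hx0 with ⟨j', hj'⟩ | hv
      · exact ⟨j', hx0, hj'⟩
      · refine (h'.not_planarAt_of_mem_vertices ⟨hx0, hv⟩ ?_).elim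
        exact φ.planarAt hxC (h.planarAt_of_mem_cell hx)
    obtain ⟨x₀, hx₀⟩ := h.cell_nonempty j
    have hx₀' := mem_openCone_of_mem hx₀ (h.norm_of_mem_cell hx₀)
    obtain ⟨j', hj'⟩ := hcell x₀ hx₀'
    let O : κ' ⊕ ι' → Set E := fun i ↦
      openCone (⋃ i' ∈ {i' | i' ≠ i}, netClosedCell G' A' i')ᶜ
    have hO : ∀ i, IsOpen (O i) := fun i ↦ h'.isOpen_away i
    have hcO : ∀ i, openCone (netCell G' A' i) ⊆ O i :=
      fun i ↦ openCone_mono (h'.cell_subset_away i)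
    have hOc : ∀ i i' x, x ∈ O i → x ∈ openCone (netCell G' A' i') → i' = i := by
      intro i i' x hx hx'
      by_contra hii
      exact hx.2 (Set.mem_biUnion hii (cell_subset i' hx'.2))
    have hpre : IsPreconnected (f '' openCone (netCell G A j)) :=
      (isPreconnected_openCone (h.isPreconnected_cell j) fun x hx ↦ h.norm_of_mem_cell hx).image f
        (φ.cont.mono hsubC)
    have hor := isPreconnected_iff_subset_of_disjoint.1 hpre (O j') (⋃ i ∈ {i | i ≠ j'}, O i)
      (hO j') (isOpen_biUnion fun i _ ↦ hO i) (by
        rintro _ ⟨x, hx, rfl⟩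
        obtain ⟨i, hi⟩ := hcell x hx
        by_cases hij : i = j'
        · subst hij; exact Or.inl (hcO _ hi)
        · exact Or.inr (Set.mem_biUnion hij (hcO _ hi))) (by
        rw [Set.eq_empty_iff_forall_notMem]
        rintro _ ⟨⟨x, hx, rfl⟩, hx1, hx2⟩
        obtain ⟨i, hi⟩ := hcell x hx
        obtain ⟨i', hi', hx2⟩ := Set.mem_iUnion₂.1 hx2
        exact hi' ((hOc _ _ _ hx2 hi).symm.trans (hOc _ _ _ hx1 hi)))
    refine ⟨j', fun x hx ↦ ?_⟩
    obtain ⟨i, hi⟩ := hcell x hx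
    rcases hor with hor | hor
    · rwa [← hOc _ _ _ (hor (Set.mem_image_of_mem f hx)) hi]
    · obtain ⟨i', hi', hx2⟩ := Set.mem_iUnion₂.1 (hor (Set.mem_image_of_mem f hx₀'))
      exact (hi' (hOc _ _ _ hx2 hj').symm).elim
  choose σ hσ using hσ
  refine ⟨fun v ↦ ‖f v‖⁻¹ • f v, σ, fun v hv ↦ ⟨?_, hτ v hv⟩, hσ, ?_⟩
  · exact (hfV v (mem_openCone_of_mem hv (norm_of_mem_vertices hv))).2
  · intro v hv j hvj
    have hcl : v ∈ closure (netCell G A j) := by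
      obtain ⟨i, s, rfl, -⟩ := h.exists_of_vertex_mem hv hvj
      change v ∈ closure (A i).interior
      rw [GreatArc.closure_interior]
      exact hvj
    have hvC := h.vertices_subset hv
    have hfcl := ((φ.cont v hvC).mono
      ((cell_subset j).trans (h.closedCell_subset j))).mem_closure_image hcl
    by_contra hn
    have hfv0 := (hfV v (mem_openCone_of_mem hv (norm_of_mem_vertices hv))).1
    obtain ⟨y, hy1, x, hx, rfl⟩ := mem_closure_iff.1 hfcl _
      (isOpen_openCone_compl (h'.isClosed_closedCell (σ j))) ⟨hfv0, hn⟩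
    exact hy1.2 (cell_subset (σ j)
      (hσ j x (mem_openCone_of_mem hx (h.norm_of_mem_cell hx))).2)

theorem eq_of_mem_openCone_singleton {v w : E} (hv : ‖v‖ = 1) (h : v ∈ openCone {w}) : v = w := by
  simpa [hv] using h.2

/-- A net cone homeomorphic to a net cone whose net is a complete bipartite graph `K₃,₃` has such
a net itself. -/
theorem exists_bipartite [Finite κ] [Finite ι] [IsEmpty κ'] (h : IsNetCone C G A)
    {A' : Fin 3 × Fin 3 → GreatArc E} (h' : IsNetCone C' G' A') (φ : HomeoOn f g C C')
    {a' b' : Fin 3 → E} (ha : ∀ i j, (A' (i, j)).endpoint false = a' i)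
    (hb : ∀ i j, (A' (i, j)).endpoint true = b' j) (hai : Function.Injective a')
    (hbi : Function.Injective b') (hab : ∀ i j, a' i ≠ b' j) :
    ∃ (a b : Fin 3 → E) (e : Fin 3 → Fin 3 → ι) (s : Fin 3 → Fin 3 → Bool),
      Function.Injective a ∧ Function.Injective b ∧ (∀ i j, a i ≠ b j) ∧
      (∀ i j, (A (e i j)).endpoint (s i j) = a i) ∧
      (∀ i j, (A (e i j)).endpoint (!(s i j)) = b j) ∧
      (∀ i j k l, e i j = e k l → i = k ∧ j = l) ∧
      C ∩ Metric.sphere 0 1 = ⋃ i, ⋃ j, (A (e i j)).carrier := by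
  have haV : ∀ i, a' i ∈ netVertices A' := fun i ↦ ⟨((i, 0), false), ha i 0⟩
  have hbV : ∀ j, b' j ∈ netVertices A' := fun j ↦ ⟨((0, j), true), hb 0 j⟩
  have hg0 : g 0 = 0 := h.map_zero h' φ hai haV
  have hf0 : f 0 = 0 := by
    have := φ.right_inv _ (h'.zero_mem (h'.vertices_subset (haV 0)))
    rwa [hg0] at this
  obtain ⟨τ, σ, hτ, hσ, -⟩ := h.exists_map_vertices_cells h' φ hg0
  obtain ⟨τ', σ', hτ', hσ', hinc⟩ := h'.exists_map_vertices_cells h φ.symm hf0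
  have hττ : ∀ v ∈ netVertices A', τ (τ' v) = v := by
    intro v hv
    have hv1 := norm_of_mem_vertices hv
    have h1 := (hτ' v hv).2 v (mem_openCone_of_mem rfl hv1)
    have h2 := (hτ _ (hτ' v hv).1).2 _ h1
    rw [φ.right_inv v (h'.vertices_subset hv)] at h2
    exact (eq_of_mem_openCone_singleton hv1 h2).symm
  have hσσ' : ∀ j, σ (σ' j) = j := by
    intro j
    obtain ⟨x, hx⟩ := h'.cell_nonempty j
    have h1 := hσ _ _ (hσ' j x (mem_openCone_of_mem hx (h'.norm_of_mem_cell hx)))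
    rw [φ.right_inv x (h'.closedCell_subset j (cell_subset j hx))] at h1
    have h2 := h1.2
    rw [h'.norm_of_mem_cell hx, inv_one, one_smul] at h2
    exact h'.eq_of_mem_cell h2 (cell_subset j hx)
  have hσσ : ∀ j, σ' (σ j) = j := by
    intro j
    obtain ⟨x, hx⟩ := h.cell_nonempty j
    have h1 := hσ' _ _ (hσ j x (mem_openCone_of_mem hx (h.norm_of_mem_cell hx)))
    rw [φ.left_inv x (h.closedCell_subset j (cell_subset j hx))] at h1
    have h2 := h1.2
    rw [h.norm_of_mem_cell hx, inv_one, one_smul] at h2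
    exact h.eq_of_mem_cell h2 (cell_subset j hx)
  have hinj : ∀ v ∈ netVertices A', ∀ w ∈ netVertices A', τ' v = τ' w → v = w := by
    intro v hv w hw hvw
    rw [← hττ v hv, hvw, hττ w hw]
  have hedge : ∀ i j, ∃ (e : ι) (s : Bool), σ' (Sum.inr (i, j)) = Sum.inr e ∧
      (A e).endpoint s = τ' (a' i) ∧ (A e).endpoint (!s) = τ' (b' j) := by
    intro i j
    have h1 := hinc _ (haV i) (Sum.inr (i, j)) (by
      rw [← ha i j]; exact GreatArc.endpoint_mem_carrier _ _)
    have h2 := hinc _ (hbV j) (Sum.inr (i, j)) (by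
      rw [← hb i j]; exact GreatArc.endpoint_mem_carrier _ _)
    obtain ⟨e, s, he, hs⟩ := h.exists_of_vertex_mem (hτ' _ (haV i)).1 h1
    obtain ⟨e', s', he', hs'⟩ := h.exists_of_vertex_mem (hτ' _ (hbV j)).1 h2
    have hee : e = e' := Sum.inr_injective (he.symm.trans he')
    subst hee
    have hss : s' ≠ s := fun hss ↦ by
      rw [hss, ← hs] at hs'
      exact hab i j (hinj _ (haV i) _ (hbV j) hs'.symm)
    have hss' : s' = !s := by cases s <;> cases s' <;> simp_all
    exact ⟨e, s, he, hs.symm, by rw [← hss', hs']⟩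
  choose e s he hs hs' using hedge
  refine ⟨fun i ↦ τ' (a' i), fun j ↦ τ' (b' j), e, s, fun i k hik ↦ ?_, fun i k hik ↦ ?_,
    fun i j hij ↦ hab i j (hinj _ (haV i) _ (hbV j) hij), hs, hs', fun i j k l hijkl ↦ ?_, ?_⟩
  · exact hai (hinj _ (haV i) _ (haV k) hik)
  · exact hbi (hinj _ (hbV i) _ (hbV k) hik)
  · have h1 : σ' (Sum.inr (i, j)) = σ' (Sum.inr (k, l)) := by rw [he, he, hijkl]
    have h2 := congrArg σ h1
    rw [hσσ', hσσ'] at h2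
    simpa using h2
  · rw [h.link_eq_closedCells]
    refine Set.Subset.antisymm (Set.iUnion_subset fun j x hx ↦ ?_) ?_
    · rcases hj : σ j with k | ⟨i, l⟩
      · exact isEmptyElim k
      · have h1 : j = Sum.inr (e i l) := by rw [← he, ← hj, hσσ]
        subst h1
        exact Set.mem_iUnion₂.2 ⟨i, l, hx⟩
    · exact Set.iUnion₂_subset fun i j ↦ Set.subset_iUnion (netClosedCell G A) (Sum.inr (e i j))

end IsNetCone

end NetHomeo

/-! ### Rigidity of bipartite nets -/

section Rigidity

/-- If `K` and `S` are the cosines and sines of the lengths of a bipartite net and `S` has rank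
one, then all the lengths are odd multiples of `π / 2`. Here `K i j` is the inner product of `a i`
and `b j`, and `hg` expresses the inner product of `b j` and `b l` from the point of view of `a i`
and of `a k`. -/
theorem cos_eq_zero_of_rank_one {K S : Fin 3 → Fin 3 → ℝ} {x y : Fin 3 → ℝ}
    (hS : ∀ i j, S i j = x i * y j) (hx : ∀ i, x i ≠ 0) (hy : ∀ j, y j ≠ 0)
    (hn : ∀ i j, K i j ^ 2 + S i j ^ 2 = 1)
    (hg : ∀ i k j l, j ≠ l →
      K i j * K i l - S i j * S i l / 2 = K k j * K k l - S k j * S k l / 2)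
    (hc : ∀ j, ∑ i, K i j / S i j = 0) (i j : Fin 3) :
    K i j = 0 := by
  let c : Fin 3 → Fin 3 → ℝ := fun i j ↦ K i j / y j
  have hK : ∀ i j, K i j = c i j * y j := fun i j ↦ by simp [c, hy]
  clear_value c
  have hsq : ∀ i k j, c i j ^ 2 + x i ^ 2 = c k j ^ 2 + x k ^ 2 := by
    intro i k j
    have h1 := (hn i j).trans (hn k j).symm
    rw [hK, hK, hS, hS] at h1
    have : y j ^ 2 * (c i j ^ 2 + x i ^ 2) = y j ^ 2 * (c k j ^ 2 + x k ^ 2) := by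
      linear_combination h1
    exact mul_left_cancel₀ (pow_ne_zero 2 (hy j)) this
  have hpr : ∀ i k j l, j ≠ l →
      c i j * c i l - x i ^ 2 / 2 = c k j * c k l - x k ^ 2 / 2 := by
    intro i k j l hjl
    have h1 := hg i k j l hjl
    simp only [hK, hS] at h1
    have : (y j * y l) * (c i j * c i l - x i ^ 2 / 2)
        = (y j * y l) * (c k j * c k l - x k ^ 2 / 2) := by
      linear_combination h1
    exact mul_left_cancel₀ (mul_ne_zero (hy j) (hy l)) this
  -- the Gram matrix of the `b j / y j` is `c i j * c i l` plus `x i ^ 2` times a form that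
  -- does not depend on `i`; two such decompositions have the same `x i ^ 2`
  have hle : ∀ i k, x i ^ 2 ≤ x k ^ 2 := by
    intro i k
    by_contra! hlt
    have h0 := hsq i k 0
    have h1 := hsq i k 1
    have h2 := hpr i k 0 1 (by decide)
    have e0 : c k 0 ^ 2 = c i 0 ^ 2 + (x i ^ 2 - x k ^ 2) := by linarith
    have e1 : c k 1 ^ 2 = c i 1 ^ 2 + (x i ^ 2 - x k ^ 2) := by linarith
    have e2 : c k 0 * c k 1 = c i 0 * c i 1 - (x i ^ 2 - x k ^ 2) / 2 := by linarith
    have e3 : (c i 0 ^ 2 + (x i ^ 2 - x k ^ 2)) * (c i 1 ^ 2 + (x i ^ 2 - x k ^ 2))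
        = (c i 0 * c i 1 - (x i ^ 2 - x k ^ 2) / 2) ^ 2 := by
      rw [← e0, ← e1, ← e2]; ring
    have hD : 0 < x i ^ 2 - x k ^ 2 := sub_pos.2 hlt
    nlinarith [mul_pos hD hD, mul_nonneg hD.le (sq_nonneg (c i 0 + c i 1)),
      mul_nonneg hD.le (sq_nonneg (c i 0)), mul_nonneg hD.le (sq_nonneg (c i 1))]
  have hxx : ∀ i k, x i ^ 2 = x k ^ 2 := fun i k ↦ le_antisymm (hle i k) (hle k i)
  -- a vanishing sum of three terms with equal squares has zero terms
  have hcol : ∀ j, c 0 j / x 0 + c 1 j / x 1 + c 2 j / x 2 = 0 := by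
    intro j
    have h1 := hc j
    rw [Fin.sum_univ_three] at h1
    simp only [hK, hS] at h1
    have : ∀ i, c i j * y j / (x i * y j) = c i j / x i :=
      fun i ↦ mul_div_mul_right _ _ (hy j)
    simpa only [this] using h1
  have hdiv : ∀ i k j, (c i j / x i) ^ 2 = (c k j / x k) ^ 2 := by
    intro i k j
    have h1 : c i j ^ 2 = c k j ^ 2 := by linarith [hxx i k, hsq i k j]
    rw [div_pow, div_pow, hxx i k, h1]
  have hz : ∀ j, (c 0 j / x 0) ^ 2 = 0 := by
    intro j
    have h1 := hcol j
    have h2 := hdiv 1 0 j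
    have h3 := hdiv 2 0 j
    generalize c 0 j / x 0 = p at *
    generalize c 1 j / x 1 = q at *
    generalize c 2 j / x 2 = r at *
    rcases sq_eq_sq_iff_eq_or_eq_neg.1 h2 with h2 | h2 <;>
      rcases sq_eq_sq_iff_eq_or_eq_neg.1 h3 with h3 | h3
    all_goals
      have : p = 0 := by linarith
      simp [this]
  have h1 : (c i j / x i) ^ 2 = 0 := (hdiv i 0 j).trans (hz j)
  have h2 : c i j = 0 := by
    have := pow_eq_zero_iff (two_ne_zero) |>.1 h1
    exact (div_eq_zero_iff.1 this).resolve_right (hx i)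
  rw [hK, h2, zero_mul]

variable {E : Type*} [NormedAddCommGroup E] [InnerProductSpace ℝ E]

/-- The same arc, started from its end `s`. -/
noncomputable def GreatArc.orient (A : GreatArc E) (s : Bool) : GreatArc E where
  p := A.endpoint s
  u := A.inward s
  len := A.len
  norm_p := A.norm_endpoint s
  norm_u := A.norm_inward s
  inner_p_u := A.inner_endpoint_inward s
  len_pos := A.len_pos
  len_lt := A.len_lt

namespace GreatArc

theorem orient_endpoint_true (A : GreatArc E) (s : Bool) :
    (A.orient s).endpoint true = A.endpoint (!s) := (A.endpoint_eq s).symm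

theorem orient_inward_true (A : GreatArc E) (s : Bool) :
    (A.orient s).inward true = A.inward (!s) := by
  have := A.inward_eq (!s)
  rw [Bool.not_not] at this
  exact this.symm

theorem orient_carrier (A : GreatArc E) (s : Bool) : (A.orient s).carrier = A.carrier :=
  (A.carrier_eq_fromEnd s).symm

end GreatArc

/-- A net with vertices `a i` and `b j` and one arc from each `a i` to each `b j`; the angles are
recorded by the inner products of the unit tangent vectors. -/
structure IsBipartiteNet (B : Fin 3 → Fin 3 → GreatArc E) (a b : Fin 3 → E) : Prop where
  start : ∀ i j, (B i j).p = a i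
  finish : ∀ i j, (B i j).endpoint true = b j
  inj_a : Function.Injective a
  inj_b : Function.Injective b
  ne : ∀ i j, a i ≠ b j
  arc_arc : ∀ i j k l, (i, j) ≠ (k, l) →
    (B i j).carrier ∩ (B k l).carrier ⊆ {a i, b j} ∩ {a k, b l}
  angle_a : ∀ i j k, j ≠ k → inner ℝ (B i j).u (B i k).u = -(1 / 2)
  angle_b : ∀ i j k, i ≠ k → inner ℝ ((B i j).inward true) ((B k j).inward true) = -(1 / 2)

theorem sum_eq_zero_of_inner {u : Fin 3 → E} (hu : ∀ i, ‖u i‖ = 1)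
    (h : ∀ j k, j ≠ k → inner ℝ (u j) (u k) = -(1 / 2)) : u 0 + u 1 + u 2 = 0 := by
  have : ‖u 0 + u 1 + u 2‖ ^ 2 = 0 := by
    rw [norm_add_sq_real, norm_add_sq_real, inner_add_left, hu, hu, hu, h 0 1 (by decide),
      h 0 2 (by decide), h 1 2 (by decide)]
    norm_num
  exact norm_eq_zero.1 (pow_eq_zero_iff two_ne_zero |>.1 this)

/-- A point of the sphere and two tangent vectors there with an angle of 120 degrees. -/
theorem linearIndependent_of_inner {p u w : E} (hp : ‖p‖ = 1) (hu : ‖u‖ = 1) (hw : ‖w‖ = 1)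
    (hpu : inner ℝ p u = 0) (hpw : inner ℝ p w = 0) (huw : inner ℝ u w = -(1 / 2)) :
    LinearIndependent ℝ ![p, u, w] := by
  rw [Fintype.linearIndependent_iff]
  intro c hc
  rw [Fin.sum_univ_three] at hc
  replace hc : c 0 • p + c 1 • u + c 2 • w = 0 := hc
  have h0 := congrArg (inner ℝ p) hc
  have h1 := congrArg (inner ℝ u) hc
  have h2 := congrArg (inner ℝ w) hc
  simp only [inner_add_right, inner_smul_right, inner_zero_right, real_inner_self_eq_norm_sq,
    hp, hu, hw, hpu, hpw, huw, real_inner_comm p u, real_inner_comm p w,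
    real_inner_comm u w] at h0 h1 h2
  intro i
  fin_cases i
  · simp only [Fin.zero_eta]; linarith
  · simp only [Fin.mk_one]; linarith
  · simp only [Fin.reduceFinMk]; linarith

namespace IsBipartiteNet

variable {B : Fin 3 → Fin 3 → GreatArc E} {a b : Fin 3 → E}

theorem swap (h : IsBipartiteNet B a b) :
    IsBipartiteNet (fun j i ↦ (B i j).orient true) b a where
  start j i := h.finish i j
  finish j i := by
    rw [GreatArc.orient_endpoint_true, ← h.start i j]; rfl
  inj_a := h.inj_b
  inj_b := h.inj_a
  ne j i := (h.ne i j).symm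
  arc_arc j i l k hne := by
    simp only [GreatArc.orient_carrier]
    rw [Set.pair_comm (b j), Set.pair_comm (b l)]
    exact h.arc_arc i j k l (by simpa [and_comm] using hne)
  angle_a j i k hik := h.angle_b i j k hik
  angle_b j i k hjk := by
    simp only [GreatArc.orient_inward_true]
    exact h.angle_a i j k hjk

theorem norm_a (h : IsBipartiteNet B a b) (i : Fin 3) : ‖a i‖ = 1 := by
  rw [← h.start i 0]; exact (B i 0).norm_p

theorem norm_b (h : IsBipartiteNet B a b) (j : Fin 3) : ‖b j‖ = 1 := h.swap.norm_a j

theorem b_eq (h : IsBipartiteNet B a b) (i j : Fin 3) :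
    b j = Real.cos (B i j).len • a i + Real.sin (B i j).len • (B i j).u := by
  rw [← h.finish i j, ← h.start i j]; rfl

theorem inner_a_u (h : IsBipartiteNet B a b) (i j : Fin 3) : inner ℝ (a i) (B i j).u = 0 := by
  rw [← h.start i j]; exact (B i j).inner_p_u

theorem inner_a_b (h : IsBipartiteNet B a b) (i j : Fin 3) :
    inner ℝ (a i) (b j) = Real.cos (B i j).len := by
  rw [h.b_eq i j, inner_add_right, inner_smul_right, inner_smul_right, h.inner_a_u,
    real_inner_self_eq_norm_sq, h.norm_a]
  ring

theorem sum_u (h : IsBipartiteNet B a b) (i : Fin 3) :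
    (B i 0).u + (B i 1).u + (B i 2).u = 0 :=
  sum_eq_zero_of_inner (u := fun j ↦ (B i j).u) (fun j ↦ (B i j).norm_u) (h.angle_a i)

theorem inner_b_b (h : IsBipartiteNet B a b) (i j l : Fin 3) (hjl : j ≠ l) :
    inner ℝ (b j) (b l) = Real.cos (B i j).len * Real.cos (B i l).len -
      Real.sin (B i j).len * Real.sin (B i l).len / 2 := by
  rw [h.b_eq i j, h.b_eq i l]
  simp only [inner_add_right, inner_add_left, inner_smul_right, inner_smul_left, h.inner_a_u,
    real_inner_comm (a i), real_inner_self_eq_norm_sq, h.norm_a, h.angle_a i j l hjl]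
  simp; ring

/-- A bipartite net is not contained in a three-dimensional subspace: a stereographic projection
would give a planar embedding of `K₃,₃`. -/
theorem false_of_subset (h : IsBipartiteNet B a b) {W : Submodule ℝ E}
    (hW : Module.finrank ℝ W = 3) (hB : ∀ i j, (B i j).p ∈ W ∧ (B i j).u ∈ W) : False := by
  have : FiniteDimensional ℝ W := Module.finite_of_finrank_pos (by omega)
  have hcW : ∀ i j t, (B i j).curve t ∈ W := fun i j t ↦
    W.add_mem (W.smul_mem _ (hB i j).1) (W.smul_mem _ (hB i j).2)
  -- a direction of `W` outside the planes of the arcs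
  obtain ⟨N, hN1, hN⟩ : ∃ N : W, ‖N‖ = 1 ∧ ∀ i j t, (N : E) ≠ (B i j).curve t := by
    classical
    let P : Fin 3 × Fin 3 → Submodule ℝ W := fun q ↦
      Submodule.span ℝ (Set.range
        ![⟨(B q.1 q.2).p, (hB q.1 q.2).1⟩, ⟨(B q.1 q.2).u, (hB q.1 q.2).2⟩])
    have hne : (⋃ p ∈ Finset.univ.image P, (p : Set W)) ≠ Set.univ := by
      refine Subspace.biUnion_ne_univ_of_top_notMem fun htop ↦ ?_
      obtain ⟨q, -, hq⟩ := Finset.mem_image.1 htop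
      have h1 : Module.finrank ℝ (P q) ≤ 2 :=
        (finrank_range_le_card _).trans (Fintype.card_fin 2).le
      rw [hq, finrank_top, hW] at h1
      omega
    obtain ⟨w, hw⟩ := (Set.ne_univ_iff_exists_notMem _).1 hne
    have hwP : ∀ q, w ∉ P q := fun q hq ↦
      hw (Set.mem_biUnion (Finset.mem_image_of_mem P (Finset.mem_univ q)) hq)
    have hw0 : w ≠ 0 := fun h0 ↦ hwP (0, 0) (h0 ▸ Submodule.zero_mem _)
    have hn := norm_ne_zero_iff.2 hw0
    refine ⟨‖w‖⁻¹ • w, by rw [norm_smul, norm_inv, norm_norm, inv_mul_cancel₀ hn], ?_⟩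
    intro i j t hEq
    refine hwP (i, j) ?_
    have h2 : ‖w‖⁻¹ • w ∈ P (i, j) := by
      have h3 : ‖w‖⁻¹ • w = Real.cos t • ⟨(B i j).p, (hB i j).1⟩ +
          Real.sin t • ⟨(B i j).u, (hB i j).2⟩ := Subtype.ext hEq
      rw [h3]
      exact (P (i, j)).add_mem
        ((P (i, j)).smul_mem _ (Submodule.subset_span ⟨0, rfl⟩))
        ((P (i, j)).smul_mem _ (Submodule.subset_span ⟨1, rfl⟩))
    have h4 := (P (i, j)).smul_mem ‖w‖ h2
    rwa [smul_smul, mul_inv_cancel₀ hn, one_smul] at h4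
  have : Fact (Module.finrank ℝ W = 2 + 1) := ⟨hW⟩
  let N' : Metric.sphere (0 : W) 1 := ⟨N, by simpa using hN1⟩
  let st := stereographic' 2 N'
  let F : Metric.sphere (0 : W) 1 → ℂ := fun x ↦ Complex.mk (st x 0) (st x 1)
  have hFi : ∀ x y, x ≠ N' → y ≠ N' → F x = F y → x = y := by
    intro x y hx hy hxy
    refine st.injOn (by simpa [st] using hx) (by simpa [st] using hy) ?_
    ext i
    fin_cases i
    exacts [(Complex.ext_iff.1 hxy).1, (Complex.ext_iff.1 hxy).2]
  have hFc : ContinuousOn F {x | x ≠ N'} := by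
    have h1 : ContinuousOn st {x | x ≠ N'} := by
      refine st.continuousOn.mono fun x hx ↦ ?_
      simpa [st] using hx
    have h2 : F = fun x ↦ ((st x 0 : ℝ) : ℂ) + ((st x 1 : ℝ) : ℂ) * Complex.I := by
      ext x; exact Complex.mk_eq_add_mul_I _ _
    have hp : ∀ i, ContinuousOn (fun x ↦ st x i) {x | x ≠ N'} := fun i ↦
      (EuclideanSpace.proj (𝕜 := ℝ) i).continuous.comp_continuousOn h1
    rw [h2]
    have h3 := hp 0
    have h4 := hp 1
    exact (Complex.continuous_ofReal.comp_continuousOn h3).add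
      ((Complex.continuous_ofReal.comp_continuousOn h4).mul continuousOn_const)
  let θ : Fin 3 → Fin 3 → ℝ → ℝ := fun i j t ↦
    (B i j).len * (Set.projIcc (0 : ℝ) 1 zero_le_one t : ℝ)
  have hθc : ∀ i j, Continuous (θ i j) := fun i j ↦
    continuous_const.mul (continuous_subtype_val.comp continuous_projIcc)
  have hθ : ∀ i j t, θ i j t ∈ Set.Icc 0 (B i j).len := fun i j t ↦ by
    have h1 := (Set.projIcc (0 : ℝ) 1 zero_le_one t).2
    have h2 := (B i j).len_pos.le
    exact ⟨mul_nonneg h2 h1.1, mul_le_of_le_one_right h2 h1.2⟩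
  let c : Fin 3 → Fin 3 → ℝ → Metric.sphere (0 : W) 1 := fun i j t ↦
    ⟨⟨(B i j).curve t, hcW i j t⟩, by simpa using (B i j).norm_curve t⟩
  have hc : ∀ i j, Continuous (c i j) := fun i j ↦
    Continuous.subtype_mk (Continuous.subtype_mk (B i j).continuous_curve _) _
  have hcN : ∀ i j t, c i j t ≠ N' := fun i j t heq ↦
    hN i j t (congrArg (fun x : Metric.sphere (0 : W) 1 ↦ ((x : W) : E)) heq).symm
  have hFeq : ∀ i j k l s t, F (c i j s) = F (c k l t) → (B i j).curve s = (B k l).curve t :=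
    fun i j k l s t heq ↦ congrArg (fun x : Metric.sphere (0 : W) 1 ↦ ((x : W) : E))
      (hFi _ _ (hcN i j s) (hcN k l t) heq)
  have hFeq' : ∀ i j k l s t, (B i j).curve s = (B k l).curve t → F (c i j s) = F (c k l t) :=
    fun i j k l s t heq ↦ congrArg F (Subtype.ext (Subtype.ext heq))
  refine false_of_planar_K33 (fun i ↦ F (c i 0 0)) (fun j ↦ F (c 0 j (B 0 j).len))
    (fun i j t ↦ F (c i j (θ i j t))) ?_ ?_ ?_ ?_
  · exact fun i j ↦ hFc.comp_continuous ((hc i j).comp (hθc i j)) fun t ↦ hcN i j _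
  · intro i j
    refine hFeq' _ _ _ _ _ _ ?_
    have : θ i j 0 = 0 := by simp [θ]
    rw [this, GreatArc.curve_zero, GreatArc.curve_zero, h.start, h.start]
  · intro i j
    refine hFeq' _ _ _ _ _ _ ?_
    have : θ i j 1 = (B i j).len := by simp [θ]
    rw [this]
    exact (h.finish i j).trans (h.finish 0 j).symm
  · intro i j k l hik hjl s t heq
    have h1 := h.arc_arc i j k l (fun h ↦ hik (Prod.ext_iff.1 h).1)
      ⟨⟨_, hθ i j s, rfl⟩, ⟨_, hθ k l t, (hFeq _ _ _ _ _ _ heq).symm⟩⟩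
    rcases h1 with ⟨h1 | h1, h2 | h2⟩
    · exact hik (h.inj_a (h1.symm.trans h2))
    · exact h.ne i l (h1.symm.trans h2)
    · exact h.ne k j (h2.symm.trans h1)
    · exact hjl (h.inj_b (h1.symm.trans h2))

/-- The hyperplanes spanned by `a i` and the tangent vectors there are not all equal, and each of
them contains all the `b j`. Hence the `b j` lie in a plane. -/
theorem exists_plane_b [FiniteDimensional ℝ E] (h : IsBipartiteNet B a b) :
    ∃ P : Submodule ℝ E, Module.finrank ℝ P ≤ 2 ∧ ∀ j, b j ∈ P := by
  let W : Fin 3 → Submodule ℝ E := fun i ↦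
    Submodule.span ℝ (Set.range ![a i, (B i 0).u, (B i 1).u])
  have hW : ∀ i, Module.finrank ℝ (W i) = 3 := fun i ↦ by
    have := finrank_span_eq_card (linearIndependent_of_inner (h.norm_a i) (B i 0).norm_u
      (B i 1).norm_u (h.inner_a_u i 0) (h.inner_a_u i 1) (h.angle_a i 0 1 (by decide)))
    simpa using this
  have ha : ∀ i, a i ∈ W i := fun i ↦ Submodule.subset_span ⟨0, rfl⟩
  have hu : ∀ i j, (B i j).u ∈ W i := by
    intro i j
    have h0 : (B i 0).u ∈ W i := Submodule.subset_span ⟨1, rfl⟩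
    have h1 : (B i 1).u ∈ W i := Submodule.subset_span ⟨2, rfl⟩
    fin_cases j
    · exact h0
    · exact h1
    · have : (B i 2).u = -((B i 0).u + (B i 1).u) := by
        rw [eq_neg_iff_add_eq_zero, add_comm]; exact h.sum_u i
      change (B i 2).u ∈ W i
      rw [this]
      exact (W i).neg_mem ((W i).add_mem h0 h1)
  have hb : ∀ i j, b j ∈ W i := fun i j ↦ by
    rw [h.b_eq i j]
    exact (W i).add_mem ((W i).smul_mem _ (ha i)) ((W i).smul_mem _ (hu i j))
  by_cases hall : ∀ i, W i = W 0
  · refine (h.false_of_subset (hW 0) fun i j ↦ ?_).elim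
    rw [← hall i, h.start]
    exact ⟨ha i, hu i j⟩
  · push Not at hall
    obtain ⟨i, hi⟩ := hall
    refine ⟨W i ⊓ W 0, ?_, fun j ↦ ⟨hb i j, hb 0 j⟩⟩
    have hlt : W i ⊓ W 0 < W 0 := by
      refine lt_of_le_of_ne inf_le_right fun heq ↦ hi ?_
      exact (Submodule.eq_of_le_of_finrank_eq (inf_eq_right.1 heq) (by rw [hW, hW])).symm
    have := Submodule.finrank_lt_finrank_of_lt hlt
    rw [hW] at this
    omega

/-- Balance of the three unit tangent vectors at `a i`. Since `a i` lies outside the plane of the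
`b j`, the vanishing of their sum gives a relation between the `b j` and one between the lengths of
the arcs. -/
theorem sin_ne_zero_and [FiniteDimensional ℝ E] (h : IsBipartiteNet B a b) (i : Fin 3) :
    (∀ j, Real.sin (B i j).len ≠ 0) ∧
      ∑ j, Real.cos (B i j).len / Real.sin (B i j).len = 0 ∧
      ∑ j, (Real.sin (B i j).len)⁻¹ • b j = 0 := by
  obtain ⟨P, hP, hbP⟩ := h.exists_plane_b
  have hpi : ∀ j, Real.sin (B i j).len = 0 → b j = -a i := by
    intro j hs
    have hc : (B i j).len = Real.pi := by
      obtain ⟨n, hn⟩ := Real.sin_eq_zero_iff.1 hs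
      have h1 := (B i j).len_pos
      have h2 := (B i j).len_lt
      rw [← hn] at h1 h2 ⊢
      have hp := Real.pi_pos
      have h3 : (0 : ℝ) < n := by by_contra! hh; nlinarith
      have h4 : (n : ℝ) < 2 := by by_contra! hh; nlinarith
      have h5 : 0 < n := by exact_mod_cast h3
      have h6 : n < 2 := by exact_mod_cast h4
      have : n = 1 := by omega
      simp [this]
    rw [h.b_eq i j, hc]; simp
  have haP : a i ∉ P := by
    intro ha
    have huP : ∀ j, Real.sin (B i j).len ≠ 0 → (B i j).u ∈ P := by
      intro j hs
      have : (B i j).u = (Real.sin (B i j).len)⁻¹ • (b j - Real.cos (B i j).len • a i) := by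
        rw [h.b_eq i j, add_sub_cancel_left, smul_smul, inv_mul_cancel₀ hs, one_smul]
      rw [this]
      exact P.smul_mem _ (P.sub_mem (hbP j) (P.smul_mem _ ha))
    -- two independent tangent vectors and `a i` do not fit into a plane, so two of the `b j`
    -- would equal `-a i`
    have hnot : ∀ j k, j ≠ k →
        ¬ (Real.sin (B i j).len ≠ 0 ∧ Real.sin (B i k).len ≠ 0) := by
      rintro j k hjk ⟨hj, hk⟩
      have hli := linearIndependent_of_inner (h.norm_a i) (B i j).norm_u
        (B i k).norm_u (h.inner_a_u i j) (h.inner_a_u i k) (h.angle_a i j k hjk)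
      have h1 := finrank_span_eq_card hli
      have h2 : Submodule.span ℝ (Set.range ![a i, (B i j).u, (B i k).u]) ≤ P := by
        rw [Submodule.span_le]
        rintro _ ⟨m, rfl⟩
        fin_cases m
        exacts [ha, huP j hj, huP k hk]
      have h3 := Submodule.finrank_mono h2
      rw [h1, Fintype.card_fin] at h3
      omega
    have hnot' : ∀ j k, j ≠ k →
        ¬ (Real.sin (B i j).len = 0 ∧ Real.sin (B i k).len = 0) := by
      rintro j k hjk ⟨hj, hk⟩
      exact hjk (h.inj_b ((hpi j hj).trans (hpi k hk).symm))
    have h01 := hnot 0 1 (by decide)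
    have h02 := hnot 0 2 (by decide)
    have h12 := hnot 1 2 (by decide)
    have h01' := hnot' 0 1 (by decide)
    have h02' := hnot' 0 2 (by decide)
    have h12' := hnot' 1 2 (by decide)
    tauto
  have hs : ∀ j, Real.sin (B i j).len ≠ 0 := fun j hs ↦ haP (by
    rw [← neg_neg (a i), ← hpi j hs]; exact P.neg_mem (hbP j))
  have hsum : ∑ j, (Real.sin (B i j).len)⁻¹ • b j =
      (∑ j, Real.cos (B i j).len / Real.sin (B i j).len) • a i := by
    have hj : ∀ j, (Real.sin (B i j).len)⁻¹ • b j =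
        (Real.cos (B i j).len / Real.sin (B i j).len) • a i + (B i j).u := fun j ↦ by
      rw [h.b_eq i j, smul_add, smul_smul, smul_smul, inv_mul_cancel₀ (hs j), one_smul,
        div_eq_inv_mul]
    rw [Finset.sum_congr rfl fun j _ ↦ hj j, Finset.sum_add_distrib, ← Finset.sum_smul,
      Fin.sum_univ_three (fun j ↦ (B i j).u), h.sum_u, add_zero]
  have hcot : ∑ j, Real.cos (B i j).len / Real.sin (B i j).len = 0 := by
    by_contra hne
    refine haP ?_
    rw [← one_smul ℝ (a i), ← inv_mul_cancel₀ hne, ← smul_smul, ← hsum]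
    exact P.smul_mem _ (P.sum_mem fun j _ ↦ P.smul_mem _ (hbP j))
  exact ⟨hs, hcot, by rw [hsum, hcot, zero_smul]⟩

/-- The lengths of a bipartite net have sines of the form `x i * y j`, because a relation with
nonzero coefficients between the pairwise independent `b j` is unique up to a factor. -/
theorem sin_mul_sin [FiniteDimensional ℝ E] (h : IsBipartiteNet B a b) (i k j l : Fin 3)
    (hjl : j ≠ l) : Real.sin (B i j).len * Real.sin (B k l).len =
      Real.sin (B i l).len * Real.sin (B k j).len := by
  obtain ⟨m, hmj, hml⟩ : ∃ m : Fin 3, m ≠ j ∧ m ≠ l := by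
    revert j l; decide
  have hsum : ∀ f : Fin 3 → E, ∑ q, f q = f j + f l + f m := by
    intro f
    have : (Finset.univ : Finset (Fin 3)) = {j, l, m} := by
      revert j l m; decide
    rw [this, Finset.sum_insert (by simp [hjl, hmj.symm]), Finset.sum_pair hml.symm, add_assoc]
  obtain ⟨hsi, -, hbi⟩ := h.sin_ne_zero_and i
  obtain ⟨hsk, -, hbk⟩ := h.sin_ne_zero_and k
  rw [hsum] at hbi hbk
  have par : ∀ {q r : Fin 3} {α β : ℝ}, α • b q + β • b r = 0 → α ≠ 0 → b r = b q ∨ b r = -b q := by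
    intro q r α β h0 hα
    have h1 : α • b q = -(β • b r) := eq_neg_of_add_eq_zero_left h0
    have h2 := congrArg norm h1
    rw [norm_neg, norm_smul, norm_smul, h.norm_b, h.norm_b, mul_one, mul_one,
      Real.norm_eq_abs, Real.norm_eq_abs] at h2
    rcases abs_eq_abs.1 h2 with h3 | h3
    · rw [← h3, ← smul_neg] at h1
      exact Or.inr (by rw [smul_right_injective E hα h1, neg_neg])
    · have h4 : β = -α := by rw [h3, neg_neg]
      rw [h4, neg_smul, neg_neg] at h1
      exact Or.inl (smul_right_injective E hα h1).symm
  have hind : ∀ α β : ℝ, α • b j + β • b l = 0 → α = 0 := by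
    intro α β h0
    by_contra hα
    rcases par h0 hα with h1 | h1
    · exact hjl (h.inj_b h1.symm)
    · have h2 : (Real.sin (B i m).len)⁻¹ • b m +
          ((Real.sin (B i j).len)⁻¹ - (Real.sin (B i l).len)⁻¹) • b j = 0 := by
        rw [h1] at hbi
        rw [← hbi]; module
      rcases par h2 (inv_ne_zero (hsi m)) with h3 | h3
      · exact hmj (h.inj_b h3.symm)
      · exact hml (h.inj_b (by rw [h1, h3, neg_neg]))
  have hrel : (Real.sin (B i m).len * (Real.sin (B i j).len)⁻¹ -
        Real.sin (B k m).len * (Real.sin (B k j).len)⁻¹) • b j +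
      (Real.sin (B i m).len * (Real.sin (B i l).len)⁻¹ -
        Real.sin (B k m).len * (Real.sin (B k l).len)⁻¹) • b l = 0 := by
    have h1 := congrArg (fun z ↦ Real.sin (B i m).len • z) hbi
    have h2 := congrArg (fun z ↦ Real.sin (B k m).len • z) hbk
    simp only [smul_add, smul_smul, mul_inv_cancel₀ (hsi m), mul_inv_cancel₀ (hsk m),
      smul_zero] at h1 h2
    rw [← sub_self (0 : E)]
    nth_rewrite 1 [← h1]
    rw [← h2]; module
  have e1 := hind _ _ hrel
  rw [e1, zero_smul, zero_add] at hrel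
  have e2 : Real.sin (B i m).len * (Real.sin (B i l).len)⁻¹ -
        Real.sin (B k m).len * (Real.sin (B k l).len)⁻¹ = 0 :=
    (smul_eq_zero.1 hrel).resolve_right fun h0 ↦ by
      have := h.norm_b l
      rw [h0, norm_zero] at this
      exact zero_ne_one this
  have n1 := hsi j
  have n2 := hsi l
  have n3 := hsk j
  have n4 := hsk l
  have n5 := hsi m
  have n6 := hsk m
  field_simp at e1 e2
  have e3 : Real.sin (B i m).len * Real.sin (B k m).len *
        (Real.sin (B i j).len * Real.sin (B k l).len) =
      Real.sin (B i m).len * Real.sin (B k m).len *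
        (Real.sin (B i l).len * Real.sin (B k j).len) := by
    linear_combination Real.sin (B k m).len * Real.sin (B i j).len * e2 -
      Real.sin (B k m).len * Real.sin (B i l).len * e1
  exact mul_left_cancel₀ (mul_ne_zero n5 n6) e3

/-- Every `a i` is orthogonal to every `b j`. -/
theorem cos_eq_zero [FiniteDimensional ℝ E] (h : IsBipartiteNet B a b) (i j : Fin 3) :
    Real.cos (B i j).len = 0 := by
  have hs : ∀ i j, Real.sin (B i j).len ≠ 0 := fun i ↦ (h.sin_ne_zero_and i).1
  refine cos_eq_zero_of_rank_one (K := fun i j ↦ Real.cos (B i j).len)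
    (S := fun i j ↦ Real.sin (B i j).len)
    (x := fun i ↦ Real.sin (B i 0).len / Real.sin (B 0 0).len)
    (y := fun j ↦ Real.sin (B 0 j).len) ?_ ?_ ?_ ?_ ?_ ?_ i j
  · intro i j
    by_cases hj : j = 0
    · subst hj; field_simp [hs]
    · have := h.sin_mul_sin i 0 j 0 hj
      have h0 := hs 0 0
      field_simp
      linarith
  · exact fun i ↦ div_ne_zero (hs _ _) (hs _ _)
  · exact fun j ↦ hs _ _
  · exact fun i j ↦ Real.cos_sq_add_sin_sq _
  · exact fun i k j l hjl ↦ (h.inner_b_b i j l hjl).symm.trans (h.inner_b_b k j l hjl)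
  · exact fun j ↦ (h.swap.sin_ne_zero_and j).2.1

/-- At most one of the arcs that start at `a i` has length `3 * π / 2`. -/
theorem not_sin_neg [FiniteDimensional ℝ E] (h : IsBipartiteNet B a b) {i j k : Fin 3}
    (hjk : j ≠ k) (hj : Real.sin (B i j).len < 0) : ¬ Real.sin (B i k).len < 0 := by
  intro hk
  -- an arc longer than `π` that starts at `a i` passes through `-a i`
  have hlong : ∀ l, Real.sin (B i l).len < 0 → -a i ∈ (B i l).carrier := by
    intro l hl
    refine ⟨Real.pi, ⟨Real.pi_pos.le, ?_⟩, ?_⟩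
    · by_contra! hlt
      exact hl.not_ge (Real.sin_nonneg_of_nonneg_of_le_pi (B i l).len_pos.le hlt.le)
    · simp [GreatArc.curve, h.start]
  rcases (h.arc_arc i j i k (by simpa using hjk) ⟨hlong j hj, hlong k hk⟩).1 with h1 | h1
  · have h2 := congrArg (inner ℝ (a i)) h1
    rw [inner_neg_right, real_inner_self_eq_norm_sq, h.norm_a] at h2
    norm_num at h2
  · have h2 := h.inner_a_b i j
    rw [h.cos_eq_zero, ← Set.mem_singleton_iff.1 h1, inner_neg_right,
      real_inner_self_eq_norm_sq, h.norm_a] at h2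
    norm_num at h2

/-- All arcs are quarter circles. The signs of the sines form a matrix of rank one with at most one
minus sign in each row and column, which leaves no room for a minus sign. -/
theorem sin_eq_one [FiniteDimensional ℝ E] (h : IsBipartiteNet B a b) (i j : Fin 3) :
    Real.sin (B i j).len = 1 := by
  have hor : ∀ i j, Real.sin (B i j).len = 1 ∨ Real.sin (B i j).len = -1 := fun i j ↦ by
    have h1 := Real.sin_sq_add_cos_sq (B i j).len
    rw [h.cos_eq_zero] at h1
    exact sq_eq_sq_iff_eq_or_eq_neg.1 (by linarith)
  refine (hor i j).resolve_right fun hneg ↦ ?_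
  have hpos : ∀ l, l ≠ j → Real.sin (B i l).len = 1 := fun l hl ↦
    (hor i l).resolve_right fun h1 ↦
      h.not_sin_neg hl.symm (by rw [hneg]; norm_num) (by rw [h1]; norm_num)
  have hpos' : ∀ k, k ≠ i → Real.sin (B k j).len = 1 := fun k hk ↦
    (hor k j).resolve_right fun h1 ↦
      h.swap.not_sin_neg (i := j) hk.symm (by change Real.sin (B i j).len < 0; rw [hneg]; norm_num)
        (by change Real.sin (B k j).len < 0; rw [h1]; norm_num)
  have hother : ∀ k l, k ≠ i → l ≠ j → Real.sin (B k l).len = -1 := fun k l hk hl ↦ by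
    have := h.sin_mul_sin i k j l hl.symm
    rw [hneg, hpos l hl, hpos' k hk] at this
    linarith
  obtain ⟨k, hk⟩ := exists_ne i
  obtain ⟨l, m, hl, hm, hlm⟩ :=
    (by decide : ∀ j : Fin 3, ∃ l m : Fin 3, l ≠ j ∧ m ≠ j ∧ l ≠ m) j
  exact h.not_sin_neg hlm (by rw [hother k l hk hl]; norm_num)
    (by rw [hother k m hk hm]; norm_num)

theorem len_eq [FiniteDimensional ℝ E] (h : IsBipartiteNet B a b) (i j : Fin 3) :
    (B i j).len = Real.pi / 2 := by
  have hc := h.cos_eq_zero i j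
  have hs := h.sin_eq_one i j
  refine GreatArc.curve_injOn (B i j) ⟨(B i j).len_pos.le, (B i j).len_lt⟩
    ⟨by positivity, by linarith [Real.pi_pos]⟩ ?_
  simp [GreatArc.curve, hc, hs]

theorem u_eq [FiniteDimensional ℝ E] (h : IsBipartiteNet B a b) (i j : Fin 3) :
    (B i j).u = b j := by
  rw [h.b_eq i j, h.cos_eq_zero, h.sin_eq_one]; simp

/-- Rigidity: two orthogonal families of three unit vectors with pairwise angles of 120 degrees. -/
theorem inner_eq [FiniteDimensional ℝ E] (h : IsBipartiteNet B a b) :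
    (∀ i k, i ≠ k → inner ℝ (a i) (a k) = -(1 / 2)) ∧
    (∀ j l, j ≠ l → inner ℝ (b j) (b l) = -(1 / 2)) ∧ ∀ i j, inner ℝ (a i) (b j) = 0 := by
  refine ⟨fun i k hik ↦ ?_, fun j l hjl ↦ ?_, fun i j ↦ ?_⟩
  · have := h.swap.angle_a 0 i k hik
    rwa [h.swap.u_eq, h.swap.u_eq] at this
  · have := h.angle_a 0 j l hjl
    rwa [h.u_eq, h.u_eq] at this
  · rw [h.inner_a_b, h.cos_eq_zero]

theorem carrier_eq [FiniteDimensional ℝ E] (h : IsBipartiteNet B a b) (i j : Fin 3) :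
    (B i j).carrier =
      (fun t ↦ Real.cos t • a i + Real.sin t • b j) '' Set.Icc 0 (Real.pi / 2) := by
  rw [GreatArc.carrier, h.len_eq]
  refine Set.image_congr fun t _ ↦ ?_
  rw [GreatArc.curve, h.start, h.u_eq]

end IsBipartiteNet

end Rigidity

/-! ### Products of two `Y` cones -/

section Product

theorem cos_two_pi_div_three : Real.cos (2 * Real.pi / 3) = -(1 / 2) := by
  rw [show 2 * Real.pi / 3 = Real.pi - Real.pi / 3 by ring, Real.cos_pi_sub,
    Real.cos_pi_div_three]

variable {E : Type*} [NormedAddCommGroup E] [InnerProductSpace ℝ E]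

/-- Two mutually orthogonal triples of unit vectors with angles of 120 degrees in each triple. -/
structure IsOrthogonalTriples (a b : Fin 3 → E) : Prop where
  norm_a : ∀ i, ‖a i‖ = 1
  norm_b : ∀ j, ‖b j‖ = 1
  inner_a : ∀ i k, i ≠ k → inner ℝ (a i) (a k) = -(1 / 2)
  inner_b : ∀ j l, j ≠ l → inner ℝ (b j) (b l) = -(1 / 2)
  inner_ab : ∀ i j, inner ℝ (a i) (b j) = 0

/-- The product of the cone over the `a i` and the cone over the `b j`. -/
def productCone (a b : Fin 3 → E) : Set E :=
  {x | ∃ i j, ∃ r t : ℝ, 0 ≤ r ∧ 0 ≤ t ∧ x = r • a i + t • b j}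

theorem isConeAtOrigin_productCone (a b : Fin 3 → E) : IsConeAtOrigin (productCone a b) := by
  rintro _ ⟨i, j, r, t, hr, ht, rfl⟩ q hq
  exact ⟨i, j, q * r, q * t, mul_nonneg hq hr, mul_nonneg hq ht, by
    rw [smul_add, smul_smul, smul_smul]⟩

theorem zero_mem_productCone (a b : Fin 3 → E) : (0 : E) ∈ productCone a b :=
  ⟨0, 0, 0, 0, le_rfl, le_rfl, by simp⟩

theorem image_productCone {F : Type*} [NormedAddCommGroup F] [InnerProductSpace ℝ F]
    (g : E ≃ₗᵢ[ℝ] F) (a b : Fin 3 → E) :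
    g '' productCone a b = productCone (fun i ↦ g (a i)) fun j ↦ g (b j) := by
  ext x
  constructor
  · rintro ⟨_, ⟨i, j, r, t, hr, ht, rfl⟩, rfl⟩
    exact ⟨i, j, r, t, hr, ht, by simp⟩
  · rintro ⟨i, j, r, t, hr, ht, rfl⟩
    exact ⟨_, ⟨i, j, r, t, hr, ht, rfl⟩, by simp⟩

/-- A cone through the origin is determined by its link. -/
theorem eq_of_link_eq {C D : Set E} (hC : IsConeAtOrigin C) (hD : IsConeAtOrigin D)
    (hC0 : (0 : E) ∈ C) (hD0 : (0 : E) ∈ D)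
    (h : C ∩ Metric.sphere 0 1 = D ∩ Metric.sphere 0 1) : C = D := by
  have key : ∀ {C D : Set E}, IsConeAtOrigin C → IsConeAtOrigin D → (0 : E) ∈ D →
      C ∩ Metric.sphere 0 1 = D ∩ Metric.sphere 0 1 → C ⊆ D := by
    intro C D hC hD hD0 h x hx
    rcases eq_or_ne x 0 with rfl | hx0
    · exact hD0
    have hn := norm_ne_zero_iff.2 hx0
    have h1 : ‖x‖⁻¹ • x ∈ C ∩ Metric.sphere 0 1 := by
      refine ⟨hC x hx _ (inv_nonneg.2 (norm_nonneg x)), ?_⟩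
      rw [mem_sphere_zero_iff_norm, norm_smul, norm_inv, norm_norm, inv_mul_cancel₀ hn]
    rw [h] at h1
    have h2 := hD _ h1.1 ‖x‖ (norm_nonneg x)
    rwa [smul_smul, mul_inv_cancel₀ hn, one_smul] at h2
  exact (key hC hD hD0 h).antisymm (key hD hC hC0 h.symm)

namespace IsOrthogonalTriples

variable {a b : Fin 3 → E}

theorem map {F : Type*} [NormedAddCommGroup F] [InnerProductSpace ℝ F]
    (h : IsOrthogonalTriples a b) (g : E ≃ₗᵢ[ℝ] F) :
    IsOrthogonalTriples (fun i ↦ g (a i)) fun j ↦ g (b j) where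
  norm_a i := by rw [g.norm_map, h.norm_a]
  norm_b j := by rw [g.norm_map, h.norm_b]
  inner_a i k hik := by rw [g.inner_map_map, h.inner_a i k hik]
  inner_b i k hik := by rw [g.inner_map_map, h.inner_b i k hik]
  inner_ab i j := by rw [g.inner_map_map, h.inner_ab]

/-- The quarter circle from `a i` to `b j`. -/
noncomputable def arc (h : IsOrthogonalTriples a b) (q : Fin 3 × Fin 3) : GreatArc E where
  p := a q.1
  u := b q.2
  len := Real.pi / 2
  norm_p := h.norm_a _
  norm_u := h.norm_b _
  inner_p_u := h.inner_ab _ _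
  len_pos := by positivity
  len_lt := by linarith [Real.pi_pos]

theorem arc_endpoint_false (h : IsOrthogonalTriples a b) (q : Fin 3 × Fin 3) :
    (h.arc q).endpoint false = a q.1 := rfl

theorem arc_endpoint_true (h : IsOrthogonalTriples a b) (q : Fin 3 × Fin 3) :
    (h.arc q).endpoint true = b q.2 := by
  simp [arc, GreatArc.endpoint, GreatArc.curve]

theorem arc_inward_false (h : IsOrthogonalTriples a b) (q : Fin 3 × Fin 3) :
    (h.arc q).inward false = b q.2 := rfl

theorem arc_inward_true (h : IsOrthogonalTriples a b) (q : Fin 3 × Fin 3) :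
    (h.arc q).inward true = a q.1 := by
  simp [arc, GreatArc.inward]

theorem arc_carrier (h : IsOrthogonalTriples a b) (q : Fin 3 × Fin 3) :
    (h.arc q).carrier =
      (fun t ↦ Real.cos t • a q.1 + Real.sin t • b q.2) '' Set.Icc 0 (Real.pi / 2) := rfl

theorem injective_a (h : IsOrthogonalTriples a b) : Function.Injective a := by
  intro i k hik
  by_contra hne
  have := h.inner_a i k hne
  rw [hik, real_inner_self_eq_norm_sq, h.norm_a] at this
  norm_num at this

theorem injective_b (h : IsOrthogonalTriples a b) : Function.Injective b := by
  intro i k hik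
  by_contra hne
  have := h.inner_b i k hne
  rw [hik, real_inner_self_eq_norm_sq, h.norm_b] at this
  norm_num at this

theorem ne (h : IsOrthogonalTriples a b) (i j : Fin 3) : a i ≠ b j := by
  intro hij
  have := h.inner_ab i j
  rw [hij, real_inner_self_eq_norm_sq, h.norm_b] at this
  norm_num at this

theorem link_eq (h : IsOrthogonalTriples a b) :
    productCone a b ∩ Metric.sphere 0 1 = ⋃ q, (h.arc q).carrier := by
  ext x
  simp only [Set.mem_iUnion, arc_carrier]
  constructor
  · rintro ⟨⟨i, j, r, t, hr, ht, rfl⟩, hx⟩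
    have hn : r ^ 2 + t ^ 2 = 1 := by
      have h1 : ‖r • a i + t • b j‖ ^ 2 = 1 := by rw [mem_sphere_zero_iff_norm.1 hx]; norm_num
      rw [norm_add_sq_real, norm_smul, norm_smul, h.norm_a, h.norm_b, inner_smul_left,
        inner_smul_right, h.inner_ab] at h1
      simpa using h1
    refine ⟨(i, j), Real.arccos r, ⟨Real.arccos_nonneg r, Real.arccos_le_pi_div_two.2 hr⟩, ?_⟩
    have h2 : Real.sqrt (1 - r ^ 2) = t := by
      rw [← hn, add_sub_cancel_left, Real.sqrt_sq ht]
    simp only [Real.cos_arccos (by linarith : -1 ≤ r) (by nlinarith : r ≤ 1), Real.sin_arccos, h2]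
  · rintro ⟨q, t, ht, rfl⟩
    refine ⟨⟨q.1, q.2, _, _, Real.cos_nonneg_of_mem_Icc ⟨by linarith [ht.1, Real.pi_pos], ht.2⟩,
      Real.sin_nonneg_of_nonneg_of_le_pi ht.1 (by linarith [ht.2, Real.pi_pos]), rfl⟩, ?_⟩
    rw [mem_sphere_zero_iff_norm]
    exact GreatArc.norm_cos_add_sin (h.norm_a _) (h.norm_b _) (h.inner_ab _ _) t

/-- Two quarter circles in different rows or columns meet only at a common end: pairing a common
point with `a i` or `b j` gives `cos t = -cos t' / 2` or `sin t = -sin t' / 2`, where both sides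
have opposite signs. -/
theorem arc_carrier_inter (h : IsOrthogonalTriples a b) {q q' : Fin 3 × Fin 3} (hne : q ≠ q') :
    (h.arc q).carrier ∩ (h.arc q').carrier ⊆ Set.range (h.arc q).endpoint := by
  rintro x ⟨⟨t, ht, htx⟩, ⟨t', ht', htx'⟩⟩
  change t ∈ Set.Icc 0 (Real.pi / 2) at ht
  change t' ∈ Set.Icc 0 (Real.pi / 2) at ht'
  replace htx : Real.cos t • a q.1 + Real.sin t • b q.2 = x := htx
  replace htx' : Real.cos t' • a q'.1 + Real.sin t' • b q'.2 = x := htx'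
  have hpi := Real.pi_pos
  have hc : ∀ {t}, t ∈ Set.Icc 0 (Real.pi / 2) → 0 ≤ Real.cos t := fun ht ↦
    Real.cos_nonneg_of_mem_Icc ⟨by linarith [ht.1], ht.2⟩
  have hs : ∀ {t}, t ∈ Set.Icc 0 (Real.pi / 2) → 0 ≤ Real.sin t := fun ht ↦
    Real.sin_nonneg_of_nonneg_of_le_pi ht.1 (by linarith [ht.2])
  have hx := htx.trans htx'.symm
  by_cases h1 : q.1 = q'.1
  · have h2 : q.2 ≠ q'.2 := fun h2 ↦ hne (Prod.ext h1 h2)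
    have h3 := congrArg (inner ℝ (b q.2)) hx
    simp only [inner_add_right, inner_smul_right, real_inner_comm (a _) (b _), h.inner_ab,
      h.inner_b _ _ h2, real_inner_self_eq_norm_sq, h.norm_b] at h3
    have h4 : Real.sin t = 0 := by linarith [hs ht, hs ht']
    have h5 : t = 0 :=
      Real.injOn_sin ⟨by linarith [ht.1], ht.2⟩ ⟨by linarith, by linarith⟩ (by simpa using h4)
    exact ⟨false, by rw [← htx, h5]; simp [arc_endpoint_false]⟩
  · have h3 := congrArg (inner ℝ (a q.1)) hx
    simp only [inner_add_right, inner_smul_right, h.inner_ab,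
      h.inner_a _ _ h1, real_inner_self_eq_norm_sq, h.norm_a] at h3
    have h4 : Real.cos t = 0 := by linarith [hc ht, hc ht']
    have h5 : t = Real.pi / 2 :=
      Real.injOn_cos ⟨ht.1, by linarith [ht.2]⟩ ⟨by linarith, by linarith⟩ (by simpa using h4)
    exact ⟨true, by rw [← htx, h5]; simp [arc_endpoint_true]⟩

theorem angle_eq_of_inner {u v : E} (hu : ‖u‖ = 1) (hv : ‖v‖ = 1)
    (h : inner ℝ u v = -(1 / 2)) : InnerProductGeometry.angle u v = 2 * Real.pi / 3 := by
  have hcos := cos_two_pi_div_three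
  rw [InnerProductGeometry.angle, hu, hv, h, mul_one, div_one, ← hcos,
    Real.arccos_cos (by positivity) (by linarith [Real.pi_pos])]

/-- The net of the product cone is `K₃,₃` with quarter circles as arcs. -/
theorem isNetCone (h : IsOrthogonalTriples a b) :
    IsNetCone (productCone a b) (Fin.elim0 : Fin 0 → Set E) h.arc where
  cone := isConeAtOrigin_productCone a b
  circle k := k.elim0
  link := by rw [h.link_eq, Set.iUnion_of_empty (ι := Fin 0), Set.empty_union]
  circle_circle k := k.elim0
  circle_arc k := k.elim0
  arc_arc q q' hne := Set.subset_inter (h.arc_carrier_inter hne)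
    (by rw [Set.inter_comm]; exact h.arc_carrier_inter hne.symm)
  three e := by
    rcases e with ⟨⟨i, j⟩, s⟩
    cases s
    · have : {f : (Fin 3 × Fin 3) × Bool | (h.arc f.1).endpoint f.2 = a i} =
          Set.range fun l : Fin 3 ↦ ((i, l), false) := by
        ext ⟨⟨k, l⟩, s⟩
        cases s
        · simp [arc_endpoint_false, h.injective_a.eq_iff, eq_comm]
        · simpa [arc_endpoint_true] using (h.ne i l).symm
      simp only [arc_endpoint_false]
      rw [this, Set.ncard_range_of_injective (fun l l' hll ↦ by simpa using hll)]
      simp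
    · have : {f : (Fin 3 × Fin 3) × Bool | (h.arc f.1).endpoint f.2 = b j} =
          Set.range fun k : Fin 3 ↦ ((k, j), true) := by
        ext ⟨⟨k, l⟩, s⟩
        cases s
        · simpa [arc_endpoint_false] using h.ne k j
        · simp [arc_endpoint_true, h.injective_b.eq_iff, eq_comm]
      simp only [arc_endpoint_true]
      rw [this, Set.ncard_range_of_injective (fun l l' hll ↦ by simpa using hll)]
      simp
  angle e f hne heq := by
    refine angle_eq_of_inner (GreatArc.norm_inward _ _) (GreatArc.norm_inward _ _) ?_
    rcases e with ⟨⟨i, j⟩, s⟩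
    rcases f with ⟨⟨k, l⟩, s'⟩
    cases s <;> cases s' <;>
      simp only [arc_endpoint_false, arc_endpoint_true, arc_inward_false, arc_inward_true] at heq ⊢
    · have := h.injective_a heq
      subst this
      exact h.inner_b j l fun hjl ↦ hne (by rw [hjl])
    · exact (h.ne _ _ heq).elim
    · exact (h.ne _ _ heq.symm).elim
    · have := h.injective_b heq
      subst this
      exact h.inner_a i k fun hik ↦ hne (by rw [hik])

end IsOrthogonalTriples

/-- The arcs of a net may be indexed by any finite type. -/
theorem IsNetCone.satisfiesNetCondition {m : ℕ} {ι : Type*} [Fintype ι] {C : Set E}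
    {G : Fin m → Set E} {A : ι → GreatArc E} (h : IsNetCone C G A) : SatisfiesNetCondition C := by
  let e : Fin (Fintype.card ι) ≃ ι := (Fintype.equivFin ι).symm
  have hinj : Function.Injective fun f : Fin (Fintype.card ι) × Bool ↦ (e f.1, f.2) :=
    fun f f' hff ↦ Prod.ext (e.injective (Prod.ext_iff.1 hff).1) (Prod.ext_iff.1 hff).2
  refine ⟨m, Fintype.card ι, G, A ∘ e, h.circle, ?_, h.circle_circle, fun k i ↦ h.circle_arc k _,
    fun i j hij ↦ h.arc_arc _ _ (e.injective.ne hij), fun f ↦ ?_,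
    fun f f' hff ↦ h.angle _ _ (hinj.ne hff)⟩
  · rw [h.link]
    congr 1
    exact (e.surjective.iUnion_comp fun i ↦ (A i).carrier).symm
  · rw [← h.three (e f.1, f.2), ← Set.ncard_image_of_injective _ hinj]
    congr 1
    ext ⟨i, s⟩
    constructor
    · rintro ⟨f', hf', hEq⟩
      rw [← hEq]
      exact hf'
    · intro hi
      exact ⟨(e.symm i, s), by simpa using hi, by simp⟩

/-- A net cone homeomorphic to a product of two `Y` cones is a product of two `Y` cones. -/
theorem IsNetCone.exists_eq_productCone [FiniteDimensional ℝ E] {κ ι : Type*} [Finite κ] [Finite ι]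
    {C : Set E} {G : κ → Set E} {A : ι → GreatArc E} (h : IsNetCone C G A) {a₀ b₀ : Fin 3 → E}
    (h₀ : IsOrthogonalTriples a₀ b₀) {f g : E → E} (φ : HomeoOn f g C (productCone a₀ b₀)) :
    ∃ a b, IsOrthogonalTriples a b ∧ C = productCone a b := by
  obtain ⟨a, b, e, s, hai, hbi, hab, hs, hs', he, hlink⟩ :=
    h.exists_bipartite h₀.isNetCone φ (fun i j ↦ h₀.arc_endpoint_false (i, j))
      (fun i j ↦ h₀.arc_endpoint_true (i, j)) h₀.injective_a h₀.injective_b h₀.ne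
  have hcos := cos_two_pi_div_three
  have hang : ∀ p q : ι × Bool, p ≠ q → (A p.1).endpoint p.2 = (A q.1).endpoint q.2 →
      inner ℝ ((A p.1).inward p.2) ((A q.1).inward q.2) = -(1 / 2) := by
    intro p q hpq heq
    have h1 := InnerProductGeometry.cos_angle_mul_norm_mul_norm
      ((A p.1).inward p.2) ((A q.1).inward q.2)
    rw [h.angle p q hpq heq, GreatArc.norm_inward, GreatArc.norm_inward, hcos] at h1
    linarith
  have hr : ∀ i j, Set.range (A (e i j)).endpoint = {a i, b j} := by
    intro i j
    rw [← hs i j, ← hs' i j]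
    ext x
    cases s i j <;> simp [or_comm]
  have hB : IsBipartiteNet (fun i j ↦ (A (e i j)).orient (s i j)) a b := by
    refine ⟨hs, fun i j ↦ ?_, hai, hbi, hab, fun i j k l hne ↦ ?_, fun i j k hjk ↦ ?_,
      fun i j k hik ↦ ?_⟩
    · rw [GreatArc.orient_endpoint_true, hs']
    · rw [GreatArc.orient_carrier, GreatArc.orient_carrier, ← hr, ← hr]
      exact h.arc_arc _ _ fun heq ↦ hne (Prod.ext (he _ _ _ _ heq).1 (he _ _ _ _ heq).2)
    · exact hang (e i j, s i j) (e i k, s i k)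
        (fun heq ↦ hjk (he _ _ _ _ (Prod.ext_iff.1 heq).1).2) ((hs i j).trans (hs i k).symm)
    · rw [GreatArc.orient_inward_true, GreatArc.orient_inward_true]
      exact hang (e i j, !(s i j)) (e k j, !(s k j))
        (fun heq ↦ hik (he _ _ _ _ (Prod.ext_iff.1 heq).1).1) ((hs' i j).trans (hs' k j).symm)
  obtain ⟨h1, h2, h3⟩ := hB.inner_eq
  have hT : IsOrthogonalTriples a b := ⟨hB.norm_a, hB.norm_b, h1, h2, h3⟩
  refine ⟨a, b, hT, eq_of_link_eq h.cone (isConeAtOrigin_productCone a b)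
    (h.zero_mem (φ.maps' (zero_mem_productCone a₀ b₀))) (zero_mem_productCone a b) ?_⟩
  rw [hlink, hT.link_eq, Set.iUnion_prod']
  refine Set.iUnion_congr fun i ↦ Set.iUnion_congr fun j ↦ ?_
  rw [← GreatArc.orient_carrier _ (s i j), hB.carrier_eq i j, hT.arc_carrier]

end Product

/-! ### The product `Y × Y` in `ℝ⁴` -/

section Standard

/-- The directions of the half lines of `ySet` in the first factor of `ℝ² × ℝ²`. -/
noncomputable def firstY (k : Fin 3) : EuclideanSpace ℝ (Fin 4) :=
  !₂[Real.cos (2 * Real.pi * (k : ℝ) / 3), Real.sin (2 * Real.pi * (k : ℝ) / 3), 0, 0]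

/-- The directions of the half lines of `ySet` in the second factor of `ℝ² × ℝ²`. -/
noncomputable def secondY (k : Fin 3) : EuclideanSpace ℝ (Fin 4) :=
  !₂[0, 0, Real.cos (2 * Real.pi * (k : ℝ) / 3), Real.sin (2 * Real.pi * (k : ℝ) / 3)]

theorem YxY_eq_productCone : YxY = productCone firstY secondY := by
  ext x
  constructor
  · rintro ⟨⟨i, r, hr, h1⟩, ⟨j, t, ht, h2⟩⟩
    refine ⟨i, j, r, t, hr, ht, ?_⟩
    have e0 := congrArg (fun y : EuclideanSpace ℝ (Fin 2) ↦ y 0) h1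
    have e1 := congrArg (fun y : EuclideanSpace ℝ (Fin 2) ↦ y 1) h1
    have e2 := congrArg (fun y : EuclideanSpace ℝ (Fin 2) ↦ y 0) h2
    have e3 := congrArg (fun y : EuclideanSpace ℝ (Fin 2) ↦ y 1) h2
    simp at e0 e1 e2 e3
    ext m
    fin_cases m <;> simp [firstY, secondY, e0, e1, e2, e3]
  · rintro ⟨i, j, r, t, hr, ht, rfl⟩
    refine ⟨⟨i, r, hr, ?_⟩, ⟨j, t, ht, ?_⟩⟩
    · ext m
      fin_cases m <;> simp [firstY, secondY]
    · ext m
      fin_cases m <;> simp [firstY, secondY]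

theorem cos_sub_third {i k : Fin 3} (hik : i ≠ k) :
    Real.cos (2 * Real.pi * (i : ℝ) / 3 - 2 * Real.pi * (k : ℝ) / 3) = -(1 / 2) := by
  have hc := cos_two_pi_div_three
  have hc' : Real.cos (2 * (2 * Real.pi / 3)) = -(1 / 2) := by
    rw [Real.cos_two_mul, hc]; norm_num
  have key : ∀ x : ℝ, (x = 2 * Real.pi / 3 ∨ x = -(2 * Real.pi / 3) ∨ x = 2 * (2 * Real.pi / 3) ∨
      x = -(2 * (2 * Real.pi / 3))) → Real.cos x = -(1 / 2) := by
    rintro x (rfl | rfl | rfl | rfl)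
    exacts [hc, by rw [Real.cos_neg, hc], hc', by rw [Real.cos_neg, hc']]
  apply key
  fin_cases i <;> fin_cases k <;> first | exact (hik rfl).elim | skip
  · right; left; simp
  · right; right; right; simp; ring
  · left; simp
  · right; left; simp; ring
  · right; right; left; simp; ring
  · left; simp; ring

theorem isOrthogonalTriples_standard : IsOrthogonalTriples firstY secondY where
  norm_a i := by
    rw [EuclideanSpace.norm_eq, Fin.sum_univ_four]
    simp [firstY]
  norm_b i := by
    rw [EuclideanSpace.norm_eq, Fin.sum_univ_four]
    simp [secondY]
  inner_a i k hik := by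
    rw [← cos_sub_third hik, Real.cos_sub, PiLp.inner_apply, Fin.sum_univ_four]
    simp [firstY]; ring
  inner_b i k hik := by
    rw [← cos_sub_third hik, Real.cos_sub, PiLp.inner_apply, Fin.sum_univ_four]
    simp [secondY]; ring
  inner_ab i k := by
    rw [PiLp.inner_apply, Fin.sum_univ_four]
    simp [firstY, secondY]

/-- An orthonormal frame adapted to two orthogonal triples. -/
noncomputable def tripleFrame {E : Type*} [NormedAddCommGroup E] [InnerProductSpace ℝ E]
    (a b : Fin 3 → E) : Fin 4 → E :=
  ![a 0, (Real.sqrt 3)⁻¹ • (a 1 - a 2), b 0, (Real.sqrt 3)⁻¹ • (b 1 - b 2)]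

theorem IsOrthogonalTriples.orthonormal_tripleFrame {E : Type*} [NormedAddCommGroup E]
    [InnerProductSpace ℝ E] {a b : Fin 3 → E} (h : IsOrthogonalTriples a b) :
    Orthonormal ℝ (tripleFrame a b) := by
  have hs : (Real.sqrt 3)⁻¹ * ((Real.sqrt 3)⁻¹ * 3) = 1 := by
    rw [← mul_assoc, ← mul_inv, Real.mul_self_sqrt (by norm_num)]; norm_num
  have tri : ∀ {c : Fin 3 → E}, (∀ i, ‖c i‖ = 1) →
      (∀ i k, i ≠ k → inner ℝ (c i) (c k) = -(1 / 2)) →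
      inner ℝ (c 0) (c 1 - c 2) = 0 ∧ inner ℝ (c 1 - c 2) (c 0) = 0 ∧
        inner ℝ (c 1 - c 2) (c 1 - c 2) = 3 := by
    intro c hc hcc
    have h1 : inner ℝ (c 0) (c 1 - c 2) = 0 := by
      rw [inner_sub_right, hcc 0 1 (by decide), hcc 0 2 (by decide), sub_self]
    refine ⟨h1, by rw [real_inner_comm, h1], ?_⟩
    rw [inner_sub_left, inner_sub_right, inner_sub_right, hcc 1 2 (by decide),
      hcc 2 1 (by decide), real_inner_self_eq_norm_sq, real_inner_self_eq_norm_sq, hc, hc]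
    norm_num
  have a0 : inner ℝ (a 0) (a 0) = 1 := by rw [real_inner_self_eq_norm_sq, h.norm_a, one_pow]
  have b0 : inner ℝ (b 0) (b 0) = 1 := by rw [real_inner_self_eq_norm_sq, h.norm_b, one_pow]
  obtain ⟨a1, a2, a3⟩ := tri h.norm_a h.inner_a
  obtain ⟨b1, b2, b3⟩ := tri h.norm_b h.inner_b
  have d1 : ∀ i, inner ℝ (a i) (b 1 - b 2) = 0 := fun i ↦ by
    rw [inner_sub_right, h.inner_ab, h.inner_ab, sub_zero]
  have d2 : ∀ j, inner ℝ (a 1 - a 2) (b j) = 0 := fun i ↦ by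
    rw [inner_sub_left, h.inner_ab, h.inner_ab, sub_zero]
  have d3 : inner ℝ (a 1 - a 2) (b 1 - b 2) = 0 := by
    rw [inner_sub_left, d1, d1, sub_zero]
  rw [orthonormal_iff_ite]
  intro i j
  fin_cases i <;> fin_cases j <;>
    simp [tripleFrame, inner_smul_left, inner_smul_right,
      a0, a1, a2, a3, b0, b1, b2, b3, d1, d2, d3, h.inner_ab, hs,
      real_inner_comm (a _) (b _), real_inner_comm (a 1 - a 2) (b _),
      real_inner_comm (a _) (b 1 - b 2), real_inner_comm (a 1 - a 2) (b 1 - b 2),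
      -inner_self_eq_norm_sq_to_K]

/-- Every product of two `Y` cones in `ℝ⁴` is a linear isometric image of the standard one. -/
theorem IsOrthogonalTriples.exists_linearIsometryEquiv {a b : Fin 3 → EuclideanSpace ℝ (Fin 4)}
    (h : IsOrthogonalTriples a b) :
    ∃ g : EuclideanSpace ℝ (Fin 4) ≃ₗᵢ[ℝ] EuclideanSpace ℝ (Fin 4),
      (∀ i, g (firstY i) = a i) ∧ ∀ j, g (secondY j) = b j := by
  have ho := h.orthonormal_tripleFrame
  have hcard : Fintype.card (Fin 4) = Module.finrank ℝ (EuclideanSpace ℝ (Fin 4)) := by simp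
  let b₀ := basisOfOrthonormalOfCardEqFinrank ho hcard
  have hb₀ : (b₀ : Fin 4 → EuclideanSpace ℝ (Fin 4)) = tripleFrame a b :=
    coe_basisOfOrthonormalOfCardEqFinrank ho hcard
  let B := b₀.toOrthonormalBasis (by rw [hb₀]; exact ho)
  have hB : ∀ x, B.repr.symm x = x 0 • a 0 + x 1 • (Real.sqrt 3)⁻¹ • (a 1 - a 2) +
      x 2 • b 0 + x 3 • (Real.sqrt 3)⁻¹ • (b 1 - b 2) := by
    intro x
    rw [← B.sum_repr_symm, Fin.sum_univ_four]
    have : (B : Fin 4 → EuclideanSpace ℝ (Fin 4)) = tripleFrame a b := by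
      rw [Module.Basis.coe_toOrthonormalBasis, hb₀]
    rw [this]
    rfl
  have c1 := cos_two_pi_div_three
  have s1 : Real.sin (2 * Real.pi / 3) = Real.sqrt 3 / 2 := by
    rw [show 2 * Real.pi / 3 = Real.pi - Real.pi / 3 by ring, Real.sin_pi_sub,
      Real.sin_pi_div_three]
  have r2 : 2 * Real.pi * 2 / 3 = 2 * (2 * Real.pi / 3) := by ring
  have c2 : Real.cos (2 * Real.pi * 2 / 3) = -(1 / 2) := by
    rw [r2, Real.cos_two_mul, c1]; norm_num
  have s2 : Real.sin (2 * Real.pi * 2 / 3) = -(Real.sqrt 3 / 2) := by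
    rw [r2, Real.sin_two_mul, c1, s1]; ring
  have h3 : Real.sqrt 3 ≠ 0 := by positivity
  have hm : Real.sqrt 3 / 2 * (Real.sqrt 3)⁻¹ = 1 / 2 := by field_simp
  have dec : ∀ {c : Fin 3 → EuclideanSpace ℝ (Fin 4)}, c 0 + c 1 + c 2 = 0 → ∀ i : Fin 3,
      Real.cos (2 * Real.pi * (i : ℝ) / 3) • c 0 +
        Real.sin (2 * Real.pi * (i : ℝ) / 3) • (Real.sqrt 3)⁻¹ • (c 1 - c 2) = c i := by
    intro c hc i
    have h0 : c 0 = -(c 1 + c 2) := by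
      rw [eq_neg_iff_add_eq_zero, ← add_assoc, hc]
    fin_cases i
    · simp
    · simp only [Fin.mk_one, Nat.cast_one, mul_one, c1, s1, smul_smul, hm, h0]
      module
    · simp only [Fin.reduceFinMk, Nat.cast_ofNat, c2, s2, smul_smul, neg_mul, hm, h0]
      module
  refine ⟨B.repr.symm, fun i ↦ ?_, fun j ↦ ?_⟩
  · rw [hB, ← dec (sum_eq_zero_of_inner h.norm_a h.inner_a) i]
    simp [firstY]
  · rw [hB, ← dec (sum_eq_zero_of_inner h.norm_b h.inner_b) j]
    simp [secondY]

end Standard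

theorem theorem6p3 (C : Set (EuclideanSpace ℝ (Fin 4))) :
    (IsConeAtOrigin C ∧ Nonempty (C ≃ₜ YxY) ∧ SatisfiesNetCondition C) ↔
      ∃ g : EuclideanSpace ℝ (Fin 4) ≃ₗᵢ[ℝ] EuclideanSpace ℝ (Fin 4), C = g '' YxY := by
  constructor
  · rintro ⟨hcone, ⟨φ⟩, m, n, G, A, h1, h2, h3, h4, h5, h6, h7⟩
    obtain ⟨f, g, hfg⟩ := HomeoOn.of_homeomorph φ
    rw [YxY_eq_productCone] at hfg
    obtain ⟨a, b, hT, rfl⟩ := IsNetCone.exists_eq_productCone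
      (⟨hcone, h1, h2, h3, h4, h5, h6, h7⟩ : IsNetCone C G A) isOrthogonalTriples_standard hfg
    obtain ⟨g, ha, hb⟩ := hT.exists_linearIsometryEquiv
    exact ⟨g, by simp only [YxY_eq_productCone, image_productCone, ha, hb]⟩
  · rintro ⟨g, rfl⟩
    refine ⟨?_, ⟨(g.toHomeomorph.image YxY).symm⟩, ?_⟩
    · rw [YxY_eq_productCone, image_productCone]
      exact isConeAtOrigin_productCone _ _
    · rw [YxY_eq_productCone, image_productCone]
      exact (isOrthogonalTriples_standard.map g).isNetCone.satisfiesNetCondition
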